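/- Let $q\ge 1$ be an integer, $\chi$ a primitive Dirichlet character mod $q$, $N\ge 1$ an integer, $h\in\mathbb Z$ with $N-2h\ne -1$, and $x>0$ real. Assume that either $\chi$ is even ($N$ arbitrary), or $\chi$ is odd and $N$ is even. Put $$F(2h-N,x,\chi)=\sum_{r=1}^{q}\sum_{n=1}^{\infty}\frac{\chi(r)\,n^{N-2h}e^{-\frac rq n^Nx}}{1-e^{-n^Nx}},\qquad G_j(a,y,\chi)=\sum_{n=1}^{\infty}\frac{1}{n^{a}}\,\frac{\chi(n)}{\exp\!\left(2\pi (ny)^{1/N}e^{-\frac{i\pi j}{2N}}\right)-1}.$$ Let $\mathcal G(\chi)=\sum_{r=1}^q\chi(r)e^{2\pi i r/q}$ and define $B_{n,\chi}$ by $\sum_{r=1}^{q}\chi(r)\frac{te^{rt}}{e^{qt}-1}=\sum_{n\ge0}B_{n,\chi}\frac{t^n}{n!}$. Then the series defining $F(2h-N,x,\chi)$ and the series $G_j\left(\frac{2h-1}{N},\frac{2\pi}{x},\bar\chi\right)$ below converge absolutely, and $$F(2h-N,x,\chi)=\zeta(2h-N)L(0,\chi)+\mathcal R_1(x)+\frac1N\,\Gamma\!\left(\tfrac{N-2h+1}{N}\right)L\!\left(\tfrac{N-2h+1}{N},\chi\right)\left(\frac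 xq\right)^{\frac{2h-N-1}{N}}$$ $$\qquad+\sum_{j=1}^{2\lfloor h/N\rfloor+1}\frac{(-1)^{j+1}}{(j+1)!}B_{j+1,\chi}\,\zeta(2h-N-Nj)\left(\frac xq\right)^{j}+\mathcal J_\chi(x),$$ where $\mathcal R_1(x)=\zeta(2h)/x$ if $q=1$ and $\mathcal R_1(x)=0$ if $q>1$, and $$\mathcal J_\chi(x)=(-1)^{h+1}\frac{\mathcal G(\chi)}{N}\left(\frac{2\pi}{x}\right)^{\frac{N-2h+1}{N}}\sum_{j\in\{-(N-1),-(N-3),\dots,N-3,N-1\}}v_{N,\chi}(j)\,e^{\frac{i\pi j(2h-1)}{2N}}\,G_j\!\left(\tfrac{2h-1}{N},\tfrac{2\pi}{x},\bar\chi\right),$$ with $v_{N,\chi}(j)=1$ if $\chi$ is even and $v_{N,\chi}(j)=(-1)^{N/2}i^{\,j-1}$ if $\chi$ is odd. Conventions: the sum over $j\ge 1$ is empty when its upper limit is less than $1$. The product $\Gamma(s_0)L(s_0,\chi)$ at $s_0=\frac{N-2h+1}{N}$ means $\lim_{s\to s_0}\Gamma(s)L(s,\chi)$, which exists (it is the ordinary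 product unless $s_0$ is a negative even integer, where the pole of $\Gamma$ is cancelled by a zero of $L$). A term of the finite sum with $2h-N-Nj=1$ is read as $0$ (in that case $B_{j+1,\chi}=0$). -/

import Mathlib

open scoped BigOperators Topology

noncomputable section

/-- The formal power series `∑ r = 1..q, χ(r) t e^{rt} / (e^{qt} - 1)`. Dividing both parts of the
fraction by `t`, the denominator is `(e^{qt} - 1) / t = ∑ k, q^{k+1} / (k+1)! t^k`, whose constant
coefficient `q` is invertible. -/
def bernoulliCharSeries {q : ℕ} (χ : DirichletCharacter ℂ q) : PowerSeries ℂ :=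
  (∑ r ∈ Finset.Icc 1 q,
      PowerSeries.C (χ (r : ZMod q)) * PowerSeries.rescale (r : ℂ) (PowerSeries.exp ℂ)) *
    (PowerSeries.mk fun k : ℕ => (q : ℂ) ^ (k + 1) / ((k + 1).factorial : ℂ))⁻¹

/-- The generating function above satisfies its defining relation. -/
theorem bernoulliCharSeries_mul {q : ℕ} [NeZero q] (χ : DirichletCharacter ℂ q) :
    bernoulliCharSeries χ * (PowerSeries.rescale (q : ℂ) (PowerSeries.exp ℂ) - 1) =
      ∑ r ∈ Finset.Icc 1 q, PowerSeries.C (χ (r : ZMod q)) *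
        (PowerSeries.X * PowerSeries.rescale (r : ℂ) (PowerSeries.exp ℂ)) := by
  have hU : PowerSeries.rescale (q : ℂ) (PowerSeries.exp ℂ) - 1 =
      (PowerSeries.mk fun k : ℕ => (q : ℂ) ^ (k + 1) / ((k + 1).factorial : ℂ)) *
        PowerSeries.X := by
    ext n
    cases n with
    | zero =>
      rw [PowerSeries.coeff_zero_mul_X, map_sub, PowerSeries.coeff_rescale, PowerSeries.coeff_exp]
      simp
    | succ k =>
      rw [PowerSeries.coeff_succ_mul_X, PowerSeries.coeff_mk]
      simp [PowerSeries.coeff_rescale, PowerSeries.coeff_exp, PowerSeries.coeff_one, div_eq_mul_inv]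
  have hc : PowerSeries.constantCoeff
      (PowerSeries.mk fun k : ℕ => (q : ℂ) ^ (k + 1) / ((k + 1).factorial : ℂ)) ≠ 0 := by
    rw [← PowerSeries.coeff_zero_eq_constantCoeff_apply, PowerSeries.coeff_mk]
    simpa using NeZero.ne q
  rw [hU, bernoulliCharSeries, mul_assoc, ← mul_assoc _ _ PowerSeries.X,
    PowerSeries.inv_mul_cancel _ hc, one_mul, Finset.sum_mul]
  exact Finset.sum_congr rfl fun r _ => by ring

/-- The generalized Bernoulli number `B_{n,χ}`, given by
`∑ r = 1..q, χ(r) t e^{rt} / (e^{qt} - 1) = ∑ n, B_{n,χ} t^n / n!`. -/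
def bernoulliChar {q : ℕ} (n : ℕ) (χ : DirichletCharacter ℂ q) : ℂ :=
  (n.factorial : ℂ) * PowerSeries.coeff n (bernoulliCharSeries χ)

/-- The `(r, n)` term `χ(r) n^{N-2h} e^{-(r/q) n^N x} / (1 - e^{-n^N x})`. -/
def lambertTerm {q : ℕ} (N : ℕ) (h : ℤ) (x : ℝ) (χ : DirichletCharacter ℂ q) (r n : ℕ) : ℂ :=
  χ (r : ZMod q) * (n : ℂ) ^ ((N : ℤ) - 2 * h) *
    Complex.exp (-((r : ℂ) / (q : ℂ)) * (n : ℂ) ^ N * (x : ℂ)) /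
      (1 - Complex.exp (-((n : ℂ) ^ N * (x : ℂ))))

/-- `F(2h - N, x, χ) = ∑_{r=1}^q ∑_{n ≥ 1} χ(r) n^{N-2h} e^{-(r/q) n^N x} / (1 - e^{-n^N x})`. -/
def lambertF {q : ℕ} (N : ℕ) (h : ℤ) (x : ℝ) (χ : DirichletCharacter ℂ q) : ℂ :=
  ∑ r ∈ Finset.Icc 1 q, ∑' n : ℕ, lambertTerm N h x χ r (n + 1)

/-- The `n`-th term `n^{-a} χ(n) / (exp(2π (n y)^{1/N} exp(-iπj/(2N))) - 1)` of `G_j(a, y, χ)`. -/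
def dualTerm {q : ℕ} (N : ℕ) (j : ℤ) (a y : ℝ) (χ : DirichletCharacter ℂ q) (n : ℕ) : ℂ :=
  1 / (((n : ℝ) ^ a : ℝ) : ℂ) *
    (χ (n : ZMod q) /
      (Complex.exp (2 * (Real.pi : ℂ) * ((((n : ℝ) * y) ^ (1 / (N : ℝ)) : ℝ) : ℂ) *
        Complex.exp (-(Complex.I * (Real.pi : ℂ) * (j : ℂ) / (2 * (N : ℂ))))) - 1))

/-- `G_j(a, y, χ)`, the sum over `n ≥ 1` of the terms above. -/
def dualG {q : ℕ} (N : ℕ) (j : ℤ) (a y : ℝ) (χ : DirichletCharacter ℂ q) : ℂ :=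
  ∑' n : ℕ, dualTerm N j a y χ (n + 1)

open Classical in
/-- The weight `v_{N,χ}(j)`: `1` for even `χ`, and `(-1)^{N/2} i^{j-1}` for odd `χ`
(used for even `N` only). -/
def vCoeff {q : ℕ} (N : ℕ) (χ : DirichletCharacter ℂ q) (j : ℤ) : ℂ :=
  if χ.Even then 1 else (-1) ^ (N / 2) * Complex.I ^ (j - 1)

/-- `𝓡₁(x)`: the residue at `1`. -/
def residueOne (q : ℕ) (h : ℤ) (x : ℝ) : ℂ :=
  if q = 1 then riemannZeta (2 * (h : ℂ)) / (x : ℂ) else 0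

/-- `𝓙_χ(x)`. The index `j = 2k - (N - 1)`, `0 ≤ k < N`, runs through
`-(N-1), -(N-3), …, N-3, N-1`; `star χ` is the complex conjugate character. -/
def dualJ {q : ℕ} [NeZero q] (N : ℕ) (h : ℤ) (x : ℝ) (χ : DirichletCharacter ℂ q) : ℂ :=
  (-1) ^ (h + 1) * (gaussSum χ ZMod.stdAddChar / (N : ℂ)) *
    (((2 * Real.pi / x) ^ (((N : ℝ) - 2 * (h : ℝ) + 1) / (N : ℝ)) : ℝ) : ℂ) *
    ∑ k ∈ Finset.range N,
      vCoeff N χ (2 * (k : ℤ) - ((N : ℤ) - 1)) *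
        Complex.exp (Complex.I * (Real.pi : ℂ) * ((2 * (k : ℤ) - ((N : ℤ) - 1) : ℤ) : ℂ) *
          (2 * (h : ℂ) - 1) / (2 * (N : ℂ))) *
        dualG N (2 * (k : ℤ) - ((N : ℤ) - 1)) ((2 * (h : ℝ) - 1) / (N : ℝ)) (2 * Real.pi / x)
          (star χ)

end

/-! Put `y = x / q` and `M(s) = Γ(s) L(s, χ) ζ(Ns - N + 2h)`. Expanding the geometric series turns
`F` into `∑ χ(m) n^(N-2h) exp(-m n^N y)` over `m, n ≥ 1`, whose Mellin transform in `y` is `M(s)`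
far to the right. Each `G_j` expands in the same way into a double exponential series in `x^(-1/N)`,
so the Mellin transform of `𝓙_χ(q y)` is computable far to the left; there it involves `Γ(w) L(1 -
s, χ̄) ζ(w)` with `w = N - 2h + 1 - Ns`.

The functional equations of `L` and `ζ` show that this is again `M(s)`. They leave the quotient of
`sin(πN(1-s)/2)` by `cos(πs/2)` (even `χ`) or by `sin(πs/2)` (odd `χ`), and a Dirichlet kernel
identity makes this quotient a finite sum of exponentials: that is the sum over `j` with weights
`v_{N,χ}(j)`. For odd `χ` the identity needs `N` even. See `completed_functional_equation` and
`mellin_dualJ`.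

Hence `F - 𝓙_χ` is the sum of the residues of `M(s) y^(-s)`: at `s = 1` (only if `q = 1`), at the
pole of the zeta factor, and at the poles `-j` of `Γ`. Trivial zeros of `L` and `ζ` remove all but
finitely many of the last kind and keep every pole simple (`tendsto_sub_mul_residue`).

The contour shift needs no decay of `M` on vertical lines (`eq_add_sum_residues`). The difference
`D` of the two sides is cut at `1`. The Mellin transform of the part on `(0, 1]`, defined to the
right, and minus that of the part on `(1, ∞)`, defined to the left, continue to one entire function.
It is bounded off a vertical strip and tends to zero to the right. Inside the strip it has at most
exponential growth, so Phragmén–Lindelöf and Liouville make it zero, and Mellin inversion gives `D =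
0`. The growth bound comes from a small calculus of functions of exponential type
(`ExpTypeOnStrips`) instead of Stirling's formula. -/

/-! ### Removable singularities and a Phragmén–Lindelöf form of Liouville's theorem -/

open Filter Complex in
/-- A function holomorphic near every point of its punctured neighbourhoods, with a limit
everywhere, extends to an entire function. -/
theorem exists_entire_extension {g : ℂ → ℂ}
    (hd : ∀ p, ∀ᶠ s in 𝓝[≠] p, DifferentiableAt ℂ g s)
    (hl : ∀ p, ∃ ℓ, Tendsto g (𝓝[≠] p) (𝓝 ℓ)) :
    ∃ E : ℂ → ℂ, Differentiable ℂ E ∧ ∀ s, ContinuousAt g s → E s = g s := by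
  choose E hE using hl
  have hcont : ∀ s, ContinuousAt g s → E s = g s := fun s hs =>
    tendsto_nhds_unique (hE s) (hs.tendsto.mono_left nhdsWithin_le_nhds)
  refine ⟨E, fun p => ?_, hcont⟩
  have hev : ∀ᶠ s in 𝓝[≠] p, E s = g s := (hd p).mono fun s hs => hcont s hs.continuousAt
  refine (Complex.analyticAt_of_differentiable_on_punctured_nhds_of_continuousAt ?_
    ?_).differentiableAt
  · have h1 := eventually_eventually_nhdsWithin.2 hev
    filter_upwards [hd p, h1, self_mem_nhdsWithin] with s hs h1 hsp
    refine hs.congr_of_eventuallyEq ?_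
    have : 𝓝[≠] p ≤ 𝓝[≠] p := le_rfl
    rwa [IsOpen.nhdsWithin_eq isOpen_compl_singleton hsp] at h1
  · rw [continuousAt_iff_punctured_nhds]
    exact (hE p).congr' (hev.mono fun s hs => hs.symm)

open Filter Complex in
/-- Subtracting the principal part at a simple pole leaves a function with a limit. -/
theorem exists_tendsto_sub_principal_part {f : ℂ → ℂ} {p c : ℂ}
    (hd : ∀ᶠ s in 𝓝[≠] p, DifferentiableAt ℂ f s)
    (hc : Tendsto (fun s => (s - p) * f s) (𝓝[≠] p) (𝓝 c)) :
    ∃ ℓ, Tendsto (fun s => f s - c / (s - p)) (𝓝[≠] p) (𝓝 ℓ) := by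
  classical
  set k : ℂ → ℂ := Function.update (fun s => (s - p) * f s) p c with hk
  have hkne : ∀ s, s ≠ p → k s = (s - p) * f s := fun s hs => Function.update_of_ne hs _ _
  have hkp : k p = c := Function.update_self _ _ _
  have han : AnalyticAt ℂ k p := by
    refine Complex.analyticAt_of_differentiable_on_punctured_nhds_of_continuousAt ?_ ?_
    · filter_upwards [hd, self_mem_nhdsWithin] with s hs hsp
      have : DifferentiableAt ℂ (fun s => (s - p) * f s) s := by fun_prop
      refine this.congr_of_eventuallyEq ?_
      filter_upwards [isOpen_compl_singleton.mem_nhds hsp] with z hz using hkne z hz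
    · rw [continuousAt_iff_punctured_nhds, hkp]
      refine hc.congr' ?_
      filter_upwards [self_mem_nhdsWithin] with s hs using (hkne s hs).symm
  -- With `k = (s - p) f` extended by `k p = c`, the difference `f - c / (s - p)` is the slope of
  -- `k` at `p`.
  refine ⟨deriv k p, ?_⟩
  have h := (hasDerivAt_iff_tendsto_slope.1 han.differentiableAt.hasDerivAt)
  refine h.congr' ?_
  filter_upwards [self_mem_nhdsWithin] with s hs
  have : s - p ≠ 0 := sub_ne_zero.2 hs
  rw [slope_def_field, hkne s hs, hkp]
  field_simp

open Filter Complex in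
/-- An entire function bounded outside a vertical strip and of finite exponential type in it is
constant. -/
theorem eq_const_of_bounded_off_strip {E : ℂ → ℂ} (hE : Differentiable ℂ E) {c C A B T : ℝ}
    (hc : 0 < c) (hC : ∀ s : ℂ, c ≤ |s.re| → ‖E s‖ ≤ C)
    (hG : ∀ s : ℂ, |s.re| ≤ c → T ≤ |s.im| → ‖E s‖ ≤ A * Real.exp (B * |s.im|)) (s w : ℂ) :
    E s = E w := by
  refine hE.apply_eq_apply_of_bounded ?_ s w
  refine isBounded_iff_forall_norm_le.2 ⟨C, ?_⟩
  rintro _ ⟨z, rfl⟩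
  rcases le_or_gt c |z.re| with h | h
  · exact hC z h
  rw [abs_lt] at h
  -- The strip has width `2c`, so Phragmén–Lindelöf admits growth `exp (B exp (k |im|))` for any `k
  -- < π / (2c)`; half of the critical value is taken.
  have hk : 0 < Real.pi / (4 * c) := by positivity
  refine PhragmenLindelof.vertical_strip (a := -c) (b := c) hE.diffContOnCl
    ⟨Real.pi / (4 * c), ?_, |B| / (Real.pi / (4 * c)), ?_⟩ (fun z hz => hC z (by simp [hz, le_abs_self]))
    (fun z hz => hC z (by simp [hz, le_abs_self])) h.1.le h.2.le
  · rw [sub_neg_eq_add, ← two_mul]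
    gcongr
    norm_num
  · refine Asymptotics.IsBigO.of_bound A ?_
    have h1 : ∀ᶠ z : ℂ in comap (_root_.abs ∘ im) atTop, T ≤ |z.im| :=
      tendsto_comap.eventually (eventually_ge_atTop T)
    filter_upwards [h1.filter_mono inf_le_left, mem_inf_of_right (mem_principal_self _)] with z hz hz2
    have hz3 : |z.re| ≤ c := abs_le.2 ⟨hz2.1.le, hz2.2.le⟩
    have h2 := hG z hz3 hz
    have hA : 0 ≤ A := by
      by_contra hA
      have := (norm_nonneg _).trans h2
      nlinarith [Real.exp_pos (B * |z.im|)]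
    refine h2.trans ?_
    rw [Real.norm_of_nonneg (Real.exp_pos _).le]
    refine mul_le_mul_of_nonneg_left (Real.exp_le_exp.2 ?_) hA
    calc B * |z.im| ≤ |B| * |z.im| := by gcongr; exact le_abs_self B
      _ = |B| / (Real.pi / (4 * c)) * (Real.pi / (4 * c) * |z.im|) := by field_simp
      _ ≤ _ := by
        gcongr
        linarith [Real.add_one_le_exp (Real.pi / (4 * c) * |z.im|)]

/-! ### Truncated Mellin transforms and comparison of two functions through residues -/

open Filter Complex Set MeasureTheory in
theorem locallyIntegrableOn_indicator {h : ℝ → ℂ} (hm : ContinuousOn h (Ioi 0)) {S : Set ℝ}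
    (hS : MeasurableSet S) : LocallyIntegrableOn (S.indicator h) (Ioi 0) := fun x hx => by
  obtain ⟨s, hs, hs'⟩ := hm.locallyIntegrableOn (μ := volume) measurableSet_Ioi x hx
  exact ⟨s, hs, hs'.indicator hS⟩

open Filter Complex Set MeasureTheory in
theorem mellin_indicator (h : ℝ → ℂ) (s : ℂ) {T : Set ℝ} (hT : MeasurableSet T) (hT0 : T ⊆ Ioi 0) :
    mellin (T.indicator h) s = ∫ t in T, (t : ℂ) ^ (s - 1) • h t := by
  rw [mellin, ← integral_indicator measurableSet_Ioi, ← integral_indicator hT]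
  congr 1 with t
  by_cases h1 : t ∈ T
  · simp only [indicator_of_mem h1, indicator_of_mem (hT0 h1)]
  · rw [indicator_of_notMem h1, indicator_apply]
    simp only [indicator_of_notMem h1, smul_zero, ite_self]

open Filter Complex Set MeasureTheory in
/-- Mellin transform of a function supported on `(0, 1]` with polynomial growth at `0`. -/
theorem mellin_indicator_Ioc {h : ℝ → ℂ} (hm : ContinuousOn h (Ioi 0)) {b C : ℝ}
    (hb : ∀ x, 0 < x → x ≤ 1 → ‖h x‖ ≤ C * x ^ (-b)) {s : ℂ} (hs : b < s.re) :
    MellinConvergent ((Ioc 0 1).indicator h) s ∧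
      DifferentiableAt ℂ (mellin ((Ioc 0 1).indicator h)) s ∧
      ‖mellin ((Ioc 0 1).indicator h) s‖ ≤ C / (s.re - b) := by
  have hloc := locallyIntegrableOn_indicator hm (measurableSet_Ioc (a := (0 : ℝ)) (b := 1))
  have htop : (Ioc 0 1).indicator h =O[atTop] (fun x : ℝ => x ^ (-(s.re + 1))) := by
    refine (Asymptotics.isBigO_zero _ _).congr' ?_ EventuallyEq.rfl
    filter_upwards [eventually_gt_atTop 1] with x hx
    exact (indicator_of_notMem (fun h => absurd h.2 (not_le.2 hx)) _).symm
  have hbot : (Ioc 0 1).indicator h =O[𝓝[>] 0] (fun x : ℝ => x ^ (-b)) := by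
    refine Asymptotics.IsBigO.of_bound C ?_
    filter_upwards [Ioc_mem_nhdsGT one_pos] with x hx
    rw [indicator_of_mem hx, Real.norm_of_nonneg (Real.rpow_nonneg hx.1.le _)]
    exact hb x hx.1 hx.2
  refine ⟨mellinConvergent_of_isBigO_rpow hloc htop (by linarith) hbot hs,
    mellin_differentiableAt_of_isBigO_rpow hloc htop (by linarith) hbot hs, ?_⟩
  have he := mellin_indicator h s (measurableSet_Ioc (a := (0 : ℝ)) (b := 1)) fun t ht => ht.1
  have hint : IntervalIntegrable (fun t : ℝ => t ^ (s.re - b - 1)) volume 0 1 :=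
    intervalIntegral.intervalIntegrable_rpow' (by linarith)
  rw [intervalIntegrable_iff_integrableOn_Ioc_of_le zero_le_one] at hint
  have hval : ∫ t in Ioc (0 : ℝ) 1, C * t ^ (s.re - b - 1) = C / (s.re - b) := by
    have h0 : s.re - b ≠ 0 := by linarith
    rw [integral_const_mul, ← intervalIntegral.integral_of_le zero_le_one,
      integral_rpow (Or.inl (by linarith)), sub_add_cancel, Real.one_rpow, Real.zero_rpow h0,
      sub_zero, mul_one_div]
  rw [he, ← hval]
  refine norm_integral_le_of_norm_le (hint.const_mul C) ?_
  refine (ae_restrict_iff' measurableSet_Ioc).2 (Eventually.of_forall fun t ht => ?_)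
  rw [norm_smul, norm_cpow_eq_rpow_re_of_pos ht.1, sub_re, one_re]
  calc t ^ (s.re - 1) * ‖h t‖ ≤ t ^ (s.re - 1) * (C * t ^ (-b)) := by
        have := Real.rpow_nonneg ht.1.le (s.re - 1)
        gcongr
        exact hb t ht.1 ht.2
    _ = C * t ^ (s.re - b - 1) := by
        rw [mul_left_comm, ← Real.rpow_add ht.1]; ring_nf

open Filter Complex Set MeasureTheory in
/-- Mellin transform of a function supported on `(1, ∞)` with polynomial growth at `∞`. -/
theorem mellin_indicator_Ioi {h : ℝ → ℂ} (hm : ContinuousOn h (Ioi 0)) {a C : ℝ}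
    (hb : ∀ x, 1 < x → ‖h x‖ ≤ C * x ^ (-a)) {s : ℂ} (hs : s.re < a) :
    MellinConvergent ((Ioi 1).indicator h) s ∧
      DifferentiableAt ℂ (mellin ((Ioi 1).indicator h)) s ∧
      ‖mellin ((Ioi 1).indicator h) s‖ ≤ C / (a - s.re) := by
  have hloc := locallyIntegrableOn_indicator hm (measurableSet_Ioi (a := (1 : ℝ)))
  have hbot : (Ioi 1).indicator h =O[𝓝[>] 0] (fun x : ℝ => x ^ (-(s.re - 1))) := by
    refine (Asymptotics.isBigO_zero _ _).congr' ?_ EventuallyEq.rfl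
    filter_upwards [Ioc_mem_nhdsGT one_pos] with x hx
    exact (indicator_of_notMem (fun h => absurd hx.2 (not_le.2 h)) _).symm
  have htop : (Ioi 1).indicator h =O[atTop] (fun x : ℝ => x ^ (-a)) := by
    refine Asymptotics.IsBigO.of_bound C ?_
    filter_upwards [eventually_gt_atTop 1] with x hx
    rw [indicator_of_mem (mem_Ioi.2 hx), Real.norm_of_nonneg (Real.rpow_nonneg (by linarith) _)]
    exact hb x hx
  refine ⟨mellinConvergent_of_isBigO_rpow hloc htop hs hbot (by linarith),
    mellin_differentiableAt_of_isBigO_rpow hloc htop hs hbot (by linarith), ?_⟩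
  have he := mellin_indicator h s measurableSet_Ioi (Ioi_subset_Ioi (zero_le_one' ℝ))
  have hint := integrableOn_Ioi_rpow_of_lt (a := s.re - a - 1) (by linarith) one_pos
  have hval : ∫ t in Ioi (1 : ℝ), C * t ^ (s.re - a - 1) = C / (a - s.re) := by
    rw [integral_const_mul, integral_Ioi_rpow_of_lt (by linarith) one_pos, Real.one_rpow,
      sub_add_cancel, ← neg_sub a s.re, neg_div_neg_eq, mul_one_div]
  rw [he, ← hval]
  refine norm_integral_le_of_norm_le (hint.const_mul C) ?_
  refine (ae_restrict_iff' measurableSet_Ioi).2 (Eventually.of_forall fun t ht => ?_)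
  have ht0 : 0 < t := one_pos.trans (mem_Ioi.1 ht)
  rw [norm_smul, norm_cpow_eq_rpow_re_of_pos ht0, sub_re, one_re]
  calc t ^ (s.re - 1) * ‖h t‖ ≤ t ^ (s.re - 1) * (C * t ^ (-a)) := by
        have := Real.rpow_nonneg ht0.le (s.re - 1)
        gcongr
        exact hb t ht
    _ = C * t ^ (s.re - a - 1) := by
        rw [mul_left_comm, ← Real.rpow_add ht0]; ring_nf

open Filter Complex Set MeasureTheory in
theorem mellin_indicator_Ioi_cpow {a s : ℂ} (hs : s.re + a.re < 0) :
    mellin ((Ioi (1 : ℝ)).indicator fun t : ℝ => (t : ℂ) ^ a) s = -(1 / (s + a)) := by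
  have he : mellin ((Ioi (1 : ℝ)).indicator fun t : ℝ => (t : ℂ) ^ a) s =
      ∫ t in Ioi (1 : ℝ), (t : ℂ) ^ (s + a - 1) := by
    rw [mellin_indicator _ s measurableSet_Ioi (Ioi_subset_Ioi (zero_le_one' ℝ))]
    refine setIntegral_congr_fun measurableSet_Ioi fun t ht => ?_
    have ht0 : (t : ℂ) ≠ 0 := ofReal_ne_zero.2 (one_pos.trans (mem_Ioi.1 ht)).ne'
    simp only [smul_eq_mul]
    rw [← cpow_add _ _ ht0]
    ring_nf
  rw [he, integral_Ioi_cpow_of_lt (by simp; linarith) one_pos, sub_add_cancel, ofReal_one, one_cpow,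
    neg_div]

open Filter Complex Set MeasureTheory in
/-- A function whose Mellin transform vanishes on a vertical line, off the real axis, vanishes
at its points of continuity. -/
theorem eq_zero_of_mellin_eq_zero {h : ℝ → ℂ} {σ x : ℝ} (hx : 0 < x)
    (hconv : MellinConvergent h σ) (h0 : ∀ s : ℂ, s.re = σ → s.im ≠ 0 → mellin h s = 0)
    (hcx : ContinuousAt h x) : h x = 0 := by
  -- The vertical line meets the real axis in one point, a null set for the inversion integral.
  have hae : ∀ᵐ y : ℝ, mellin h (σ + y * I) = 0 := by
    have : ∀ᵐ y : ℝ, y ≠ 0 := by simp [ae_iff]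
    filter_upwards [this] with y hy
    exact h0 _ (by simp) (by simpa using hy)
  have hv : VerticalIntegrable (mellin h) σ := by
    rw [VerticalIntegrable]
    exact (integrable_zero ℝ ℂ volume).congr (hae.mono fun y hy => hy.symm)
  rw [← mellinInv_mellin_eq σ h hx hconv hv hcx, mellinInv]
  have : ∫ y : ℝ, (x : ℂ) ^ (-(σ + y * I) : ℂ) • mellin h (σ + y * I) = 0 := by
    rw [← integral_zero ℝ ℂ]
    exact integral_congr_ae (hae.mono fun y hy => by simp [hy])
  rw [this, smul_zero]

open Filter Complex Set MeasureTheory in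
/-- If the Mellin transforms of `f` (to the right) and of `g` (to the left) are the two ends of a
meromorphic function with finitely many simple poles, of finite exponential type in the strip
between them, then `f` and `g` differ by the sum over the poles. -/
theorem eq_add_sum_residues {f g : ℝ → ℂ} {M E : ℂ → ℂ} {ι : Type*} {S : Finset ι} {p : ι → ℝ} {r : ι → ℂ}
    {c A B : ℝ}
    (hc : 0 < c) (hS : ∀ i ∈ S, |p i| ≤ c)
    (hf : ContinuousOn f (Ioi 0)) (hg : ContinuousOn g (Ioi 0))
    (hfb : ∀ σ, c ≤ σ → ∃ C, ∀ x, 0 < x → ‖f x‖ ≤ C * x ^ (-σ))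
    (hgb : ∀ σ, σ ≤ -c → ∃ C, ∀ x, 0 < x → ‖g x‖ ≤ C * x ^ (-σ))
    (hfM : ∀ s : ℂ, c < s.re → s.im ≠ 0 → mellin f s = M s)
    (hgM : ∀ s : ℂ, s.re < -c → s.im ≠ 0 → mellin g s = M s)
    (hE : Differentiable ℂ E)
    (hEM : ∀ s : ℂ, s.im ≠ 0 → E s = M s - ∑ i ∈ S, r i / (s - p i))
    (hG : ∀ s : ℂ, |s.re| ≤ c + 1 → 1 ≤ |s.im| → ‖M s‖ ≤ A * Real.exp (B * |s.im|))
    {x : ℝ} (hx : 0 < x) : f x = g x + ∑ i ∈ S, r i * (x : ℂ) ^ (-p i : ℂ) := by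
  set R : ℝ → ℂ := fun x => ∑ i ∈ S, r i * (x : ℂ) ^ (-p i : ℂ) with hR
  set D : ℝ → ℂ := fun x => f x - g x - R x with hD
  have hRc : ContinuousOn R (Ioi 0) := by
    refine continuousOn_finsetSum _ fun p _ => continuousOn_const.mul ?_
    exact fun t ht => (continuousAt_ofReal_cpow_const t _ (Or.inr (ne_of_gt ht))).continuousWithinAt
  have hDc : ContinuousOn D (Ioi 0) := (hf.sub hg).sub hRc
  have hRn : ∀ t : ℝ, 0 < t → ‖R t‖ ≤ ∑ i ∈ S, ‖r i‖ * t ^ (-p i) := fun t ht => by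
    refine (norm_sum_le _ _).trans (Finset.sum_le_sum fun p _ => ?_)
    rw [norm_mul, norm_cpow_eq_rpow_re_of_pos ht, neg_re, ofReal_re]
  obtain ⟨Cf, hCf⟩ := hfb c le_rfl
  obtain ⟨Cg, hCg⟩ := hgb (-c) le_rfl
  -- On the strip `|re s| ≤ c + 1` the exponents `±(c + 2)` leave a gap of at least `1`, so the
  -- transforms of `f` on `(1, ∞)` and of `g` on `(0, 1]` are bounded there by these constants.
  obtain ⟨Cf', hCf'⟩ := hfb (c + 2) (by linarith)
  obtain ⟨Cg', hCg'⟩ := hgb (-(c + 2)) (by linarith)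
  have pos_of : ∀ {φ : ℝ → ℂ} {C σ : ℝ}, (∀ x, 0 < x → ‖φ x‖ ≤ C * x ^ (-σ)) → 0 ≤ C := by
    intro φ C σ h
    simpa using (norm_nonneg _).trans (h 1 one_pos)
  have hCf0 := pos_of hCf
  have hCg0 := pos_of hCg
  have hCf0' := pos_of hCf'
  have hCg0' := pos_of hCg'
  set K : ℝ := Cf + Cg + ∑ i ∈ S, ‖r i‖ with hK
  have hK0 : 0 ≤ K := by positivity
  have hD0 : ∀ t : ℝ, 0 < t → t ≤ 1 → ‖D t‖ ≤ K * t ^ (-c) := fun t ht ht1 => by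
    have h1 : ∀ p : ℝ, |p| ≤ c → t ^ (-p) ≤ t ^ (-c) := fun p hp =>
      Real.rpow_le_rpow_of_exponent_ge ht ht1 (neg_le_neg ((le_abs_self p).trans hp))
    calc ‖D t‖ ≤ ‖f t‖ + ‖g t‖ + ‖R t‖ :=
          (norm_sub_le _ _).trans (add_le_add_left (norm_sub_le _ _) _)
      _ ≤ Cf * t ^ (-c) + Cg * t ^ (-c) + ∑ i ∈ S, ‖r i‖ * t ^ (-c) := by
          refine add_le_add (add_le_add (hCf t ht) ((hCg t ht).trans ?_)) ((hRn t ht).trans ?_)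
          · exact mul_le_mul_of_nonneg_left (h1 _ (by rw [abs_neg, abs_of_pos hc])) hCg0
          · exact Finset.sum_le_sum fun i hp =>
              mul_le_mul_of_nonneg_left (h1 _ (hS i hp)) (norm_nonneg _)
      _ = K * t ^ (-c) := by rw [← Finset.sum_mul]; ring
  have hD1 : ∀ t : ℝ, 1 < t → ‖D t‖ ≤ K * t ^ (-(-c)) := fun t ht1 => by
    have ht : 0 < t := one_pos.trans ht1
    have h1 : ∀ p : ℝ, |p| ≤ c → t ^ (-p) ≤ t ^ (-(-c)) := fun p hp =>
      Real.rpow_le_rpow_of_exponent_le ht1.le (by linarith [neg_abs_le p])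
    calc ‖D t‖ ≤ ‖f t‖ + ‖g t‖ + ‖R t‖ :=
          (norm_sub_le _ _).trans (add_le_add_left (norm_sub_le _ _) _)
      _ ≤ Cf * t ^ (-(-c)) + Cg * t ^ (-(-c)) + ∑ i ∈ S, ‖r i‖ * t ^ (-(-c)) := by
          refine add_le_add (add_le_add ((hCf t ht).trans ?_) (hCg t ht)) ((hRn t ht).trans ?_)
          · exact mul_le_mul_of_nonneg_left (h1 _ (abs_of_pos hc).le) hCf0
          · exact Finset.sum_le_sum fun i hp =>
              mul_le_mul_of_nonneg_left (h1 _ (hS i hp)) (norm_nonneg _)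
      _ = K * t ^ (-(-c)) := by rw [← Finset.sum_mul]; ring
  -- the four pieces of `f` and `g`
  have mf0 : ∀ s : ℂ, c < s.re → _ := fun s hs =>
    mellin_indicator_Ioc hf (fun t ht _ => hCf t ht) hs
  have mg1 : ∀ s : ℂ, s.re < -c → _ := fun s hs =>
    mellin_indicator_Ioi hg (fun t ht => hCg t (one_pos.trans ht)) hs
  -- The tail of `f` decays faster than any power, and `g` vanishes at `0` to every order, so these
  -- two pieces have entire Mellin transforms.
  have mf1 : ∀ s : ℂ, MellinConvergent ((Ioi 1).indicator f) s ∧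
      DifferentiableAt ℂ (mellin ((Ioi 1).indicator f)) s := fun s => by
    obtain ⟨C, hC⟩ := hfb (max c (s.re + 1)) (le_max_left _ _)
    have := mellin_indicator_Ioi hf (fun t ht => hC t (one_pos.trans ht)) (s := s)
      (lt_of_lt_of_le (by linarith) (le_max_right _ _))
    exact ⟨this.1, this.2.1⟩
  have mg0 : ∀ s : ℂ, MellinConvergent ((Ioc 0 1).indicator g) s ∧
      DifferentiableAt ℂ (mellin ((Ioc 0 1).indicator g)) s := fun s => by
    obtain ⟨C, hC⟩ := hgb (min (-c) (s.re - 1)) (min_le_left _ _)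
    have := mellin_indicator_Ioc hg (fun t ht _ => hC t ht) (s := s)
      (lt_of_le_of_lt (min_le_right _ _) (by linarith))
    exact ⟨this.1, this.2.1⟩
  have split : ∀ φ : ℝ → ℂ, ∀ s : ℂ, MellinConvergent ((Ioc 0 1).indicator φ) s →
      MellinConvergent ((Ioi 1).indicator φ) s →
      mellin φ s = mellin ((Ioc 0 1).indicator φ) s + mellin ((Ioi 1).indicator φ) s := by
    intro φ s h1 h2
    rw [← (hasMellin_add h1 h2).2, mellin, mellin]
    refine setIntegral_congr_fun measurableSet_Ioi fun t ht => ?_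
    have : φ t = (Ioc 0 1).indicator φ t + (Ioi 1).indicator φ t := by
      rcases le_or_gt t 1 with h | h
      · rw [indicator_of_mem (show t ∈ Ioc (0 : ℝ) 1 from ⟨ht, h⟩), indicator_of_notMem (by simpa using h), add_zero]
      · rw [indicator_of_notMem (fun h' => absurd h'.2 (not_le.2 h)), indicator_of_mem (mem_Ioi.2 h),
          zero_add]
    simp only [← this]
  have mR0 : ∀ s : ℂ, c < s.re → MellinConvergent ((Ioc 0 1).indicator R) s ∧
      mellin ((Ioc 0 1).indicator R) s = ∑ i ∈ S, r i / (s - p i) := by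
    intro s hs
    have h1 : ∀ i ∈ S, HasMellin ((Ioc 0 1).indicator fun t : ℝ => (t : ℂ) ^ (-p i : ℂ)) s
        (1 / (s + -p i)) := fun i hp => hasMellin_cpow_Ioc _ (by
          have := (le_abs_self (p i)).trans (hS i hp)
          simp only [neg_re, ofReal_re]; linarith)
    have h2 : ∀ t : ℝ, (t : ℂ) ^ (s - 1) • (Ioc 0 1).indicator R t = ∑ i ∈ S, r i *
        ((t : ℂ) ^ (s - 1) • (Ioc 0 1).indicator (fun t : ℝ => (t : ℂ) ^ (-p i : ℂ)) t) := by
      intro t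
      by_cases ht : t ∈ Ioc (0 : ℝ) 1
      · simp only [indicator_of_mem ht, hR, smul_eq_mul, Finset.mul_sum]
        exact Finset.sum_congr rfl fun p _ => by ring
      · simp [indicator_of_notMem ht]
    constructor
    · simp only [MellinConvergent, h2]
      exact integrable_finsetSum _ fun i hp => (h1 i hp).1.const_mul _
    · simp only [mellin, h2]
      rw [integral_finsetSum _ fun i hp => (h1 i hp).1.const_mul _]
      refine Finset.sum_congr rfl fun i hp => ?_
      rw [integral_const_mul, ← mellin, (h1 i hp).2, mul_one_div, sub_eq_add_neg]
  have mR1 : ∀ s : ℂ, s.re < -c → MellinConvergent ((Ioi 1).indicator R) s ∧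
      mellin ((Ioi 1).indicator R) s = -∑ i ∈ S, r i / (s - p i) := by
    intro s hs
    have hp' : ∀ i ∈ S, s.re < p i := fun i hi => by linarith [neg_abs_le (p i), hS i hi]
    have hpc : ∀ p : ℝ, ContinuousOn (fun t : ℝ => (t : ℂ) ^ (-p : ℂ)) (Ioi 0) := fun p t ht =>
      (continuousAt_ofReal_cpow_const t _ (Or.inr (ne_of_gt ht))).continuousWithinAt
    have h1 : ∀ i ∈ S, MellinConvergent ((Ioi 1).indicator fun t : ℝ => (t : ℂ) ^ (-p i : ℂ)) s :=
      fun i hp => (mellin_indicator_Ioi (hpc (p i)) (C := 1) (fun t ht => by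
        rw [norm_cpow_eq_rpow_re_of_pos (one_pos.trans ht), neg_re, ofReal_re, one_mul])
        (hp' i hp)).1
    have h2 : ∀ t : ℝ, (t : ℂ) ^ (s - 1) • (Ioi 1).indicator R t = ∑ i ∈ S, r i *
        ((t : ℂ) ^ (s - 1) • (Ioi 1).indicator (fun t : ℝ => (t : ℂ) ^ (-p i : ℂ)) t) := by
      intro t
      by_cases ht : t ∈ Ioi (1 : ℝ)
      · simp only [indicator_of_mem ht, hR, smul_eq_mul, Finset.mul_sum]
        exact Finset.sum_congr rfl fun p _ => by ring
      · simp [indicator_of_notMem ht]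
    constructor
    · simp only [MellinConvergent, h2]
      exact integrable_finsetSum _ fun i hp => (h1 i hp).const_mul _
    · simp only [mellin, h2]
      rw [integral_finsetSum _ fun i hp => (h1 i hp).const_mul _, ← Finset.sum_neg_distrib]
      refine Finset.sum_congr rfl fun i hp => ?_
      rw [integral_const_mul, ← mellin, mellin_indicator_Ioi_cpow (by
        simpa using hp' i hp), mul_neg, mul_one_div, sub_eq_add_neg]
  -- the entire function
  set G : ℂ → ℂ := fun s => E s - mellin ((Ioi 1).indicator f) s - mellin ((Ioc 0 1).indicator g) s
    with hGdef
  have hGd : Differentiable ℂ G := fun s => (hE s |>.sub (mf1 s).2).sub (mg0 s).2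
  have indsub : ∀ T : Set ℝ, T.indicator D =
      fun t => T.indicator f t - T.indicator g t - T.indicator R t := fun T => by
    ext t
    by_cases ht : t ∈ T
    · simp only [indicator_of_mem ht, hD]
    · simp [indicator_of_notMem ht]
  have hright : ∀ s : ℂ, c < s.re → s.im ≠ 0 → mellin ((Ioc 0 1).indicator D) s = G s := by
    intro s hs him
    have h1 := hasMellin_sub (mf0 s hs).1 (mg0 s).1
    have h2 := hasMellin_sub h1.1 (mR0 s hs).1
    rw [indsub, h2.2, h1.2, (mR0 s hs).2]
    simp only [hGdef]
    rw [hEM s him, ← hfM s hs him, split f s (mf0 s hs).1 (mf1 s).1]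
    ring
  have hleft : ∀ s : ℂ, s.re < -c → s.im ≠ 0 → mellin ((Ioi 1).indicator D) s = -G s := by
    intro s hs him
    have h1 := hasMellin_sub (mf1 s).1 (mg1 s hs).1
    have h2 := hasMellin_sub h1.1 (mR1 s hs).1
    rw [indsub, h2.2, h1.2, (mR1 s hs).2]
    simp only [hGdef]
    rw [hEM s him, ← hgM s hs him, split g s (mg0 s).1 (mg1 s hs).1]
    ring
  have bright : ∀ s : ℂ, c < s.re → s.im ≠ 0 → ‖G s‖ ≤ K / (s.re - c) := fun s hs him => by
    rw [← hright s hs him]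
    exact (mellin_indicator_Ioc hDc hD0 hs).2.2
  have bleft : ∀ s : ℂ, s.re < -c → s.im ≠ 0 → ‖G s‖ ≤ K / (-c - s.re) := fun s hs him => by
    rw [← norm_neg, ← hleft s hs him]
    exact (mellin_indicator_Ioi hDc hD1 hs).2.2
  have hbd : ∀ s : ℂ, c + 1 ≤ |s.re| → ‖G s‖ ≤ K := by
    have h1 : ∀ s : ℂ, c + 1 ≤ |s.re| → s.im ≠ 0 → ‖G s‖ ≤ K := by
      intro s hs him
      rcases le_abs.1 hs with h | h
      · exact (bright s (by linarith) him).trans (div_le_self hK0 (by linarith))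
      · exact (bleft s (by linarith) him).trans (div_le_self hK0 (by linarith))
    intro s hs
    by_cases him : s.im = 0
    -- Nothing is assumed about `M` on the real axis; there the bound follows by continuity of `G`
    -- along the vertical direction.
    · have ht : Tendsto (fun y : ℝ => ‖G (s + y * I)‖) (𝓝[≠] 0) (𝓝 ‖G s‖) := by
        have h2 : ContinuousAt (fun y : ℝ => ‖G (s + y * I)‖) 0 :=
          (hGd.continuous.comp (by fun_prop : Continuous fun y : ℝ => s + y * I)).norm.continuousAt
        have := h2.tendsto.mono_left (nhdsWithin_le_nhds (s := {0}ᶜ))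
        simpa using this
      refine le_of_tendsto ht ?_
      filter_upwards [self_mem_nhdsWithin] with y hy
      exact h1 _ (by simpa using hs) (by simpa [him] using hy)
    · exact h1 s hs him
  have hconst := eq_const_of_bounded_off_strip (T := 1)
    (A := |A| + ∑ i ∈ S, ‖r i‖ + Cf' + Cg') (B := |B|) hGd
    (by linarith : 0 < c + 1) hbd (by
      intro s hs him
      have him0 : s.im ≠ 0 := by
        intro h
        rw [h, abs_zero] at him
        linarith
      have hs' := abs_le.1 hs
      have he1 : (1 : ℝ) ≤ Real.exp (|B| * |s.im|) := Real.one_le_exp (by positivity)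
      have e1 : ‖M s‖ ≤ |A| * Real.exp (|B| * |s.im|) := by
        refine (hG s hs him).trans ?_
        gcongr
        · exact le_abs_self A
        · exact le_abs_self B
      have e2 : ‖∑ i ∈ S, r i / (s - p i)‖ ≤ ∑ i ∈ S, ‖r i‖ := by
        refine (norm_sum_le _ _).trans (Finset.sum_le_sum fun i _ => ?_)
        rw [norm_div]
        refine div_le_self (norm_nonneg _) (him.trans ?_)
        simpa using abs_im_le_norm (s - p i)
      have e3 : ‖mellin ((Ioi 1).indicator f) s‖ ≤ Cf' :=
        (mellin_indicator_Ioi hf (fun t ht => hCf' t (one_pos.trans ht)) (by linarith)).2.2.trans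
          (div_le_self hCf0' (by linarith))
      have e4 : ‖mellin ((Ioc 0 1).indicator g) s‖ ≤ Cg' :=
        (mellin_indicator_Ioc hg (fun t ht _ => hCg' t ht) (by linarith)).2.2.trans
          (div_le_self hCg0' (by linarith))
      have hr0 : 0 ≤ ∑ i ∈ S, ‖r i‖ := Finset.sum_nonneg fun p _ => norm_nonneg _
      calc ‖G s‖ ≤ ‖M s‖ + ‖∑ i ∈ S, r i / (s - p i)‖ + ‖mellin ((Ioi 1).indicator f) s‖ +
            ‖mellin ((Ioc 0 1).indicator g) s‖ := by
            simp only [hGdef, hEM s him0]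
            refine (norm_sub_le _ _).trans (add_le_add_left ((norm_sub_le _ _).trans
              (add_le_add_left (norm_sub_le _ _) _)) _)
        _ ≤ |A| * Real.exp (|B| * |s.im|) + ∑ i ∈ S, ‖r i‖ + Cf' + Cg' := by gcongr
        _ ≤ _ := by nlinarith)
  -- The constant value is at most `K / (σ - c)` for every `σ > c`, hence zero.
  have hG0 : ∀ s, G s = 0 := by
    intro s
    have ht : Tendsto (fun σ : ℝ => K / (σ - c)) atTop (𝓝 0) :=
      tendsto_const_nhds.div_atTop (tendsto_atTop_add_const_right _ _ tendsto_id)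
    have : ‖G s‖ ≤ 0 := by
      refine ge_of_tendsto ht ?_
      filter_upwards [eventually_gt_atTop c] with σ hσ
      rw [hconst s (σ + I)]
      simpa using bright (σ + I) (by simpa using hσ) (by simp)
    exact norm_le_zero_iff.1 this
  have z0 : ∀ t : ℝ, 0 < t → t < 1 → D t = 0 := by
    intro t ht ht1
    have := eq_zero_of_mellin_eq_zero (h := (Ioc 0 1).indicator D) (σ := c + 1) ht
      (mellin_indicator_Ioc hDc hD0 (by simp)).1
      (fun s hs him => by rw [hright s (by linarith) him, hG0]) (by
        refine (hDc.continuousAt (Ioi_mem_nhds ht)).congr ?_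
        filter_upwards [Ioo_mem_nhds ht ht1] with y hy
        rw [indicator_of_mem (show y ∈ Ioc (0 : ℝ) 1 from ⟨hy.1, hy.2.le⟩)])
    rwa [indicator_of_mem (show t ∈ Ioc (0 : ℝ) 1 from ⟨ht, ht1.le⟩)] at this
  have z1 : ∀ t : ℝ, 1 < t → D t = 0 := by
    intro t ht1
    have ht := one_pos.trans ht1
    have := eq_zero_of_mellin_eq_zero (h := (Ioi 1).indicator D) (σ := -(c + 1)) ht
      (mellin_indicator_Ioi hDc hD1 (by simp)).1
      (fun s hs him => by rw [hleft s (by linarith) him, hG0, neg_zero]) (by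
        refine (hDc.continuousAt (Ioi_mem_nhds ht)).congr ?_
        filter_upwards [Ioi_mem_nhds ht1] with y hy
        rw [indicator_of_mem hy])
    rwa [indicator_of_mem (mem_Ioi.2 ht1)] at this
  have hDx : D x = 0 := by
    rcases lt_trichotomy x 1 with h | rfl | h
    · exact z0 x hx h
    -- The truncated functions may jump at the cut, so the value at `1` is obtained as a limit from
    -- the right.
    · have h1 := (hDc.continuousAt (Ioi_mem_nhds one_pos)).tendsto.mono_left
        (nhdsWithin_le_nhds (s := Ioi 1))
      refine tendsto_nhds_unique h1 (tendsto_const_nhds.congr' ?_)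
      filter_upwards [self_mem_nhdsWithin] with y hy using (z1 y hy).symm
    · exact z1 x h
  simp only [hD] at hDx
  linear_combination hDx

/-! ### Exponential series and their Mellin transforms -/

/-- This is `v ≤ exp v` at `v = r u / σ`, raised to the power `σ`. -/
theorem Real.exp_neg_mul_le_rpow {r σ u : ℝ} (hr : 0 < r) (hσ : 0 < σ) (hu : 0 < u) :
    Real.exp (-(r * u)) ≤ (σ / r) ^ σ * u ^ (-σ) := by
  have h1 : (r * u / σ) ^ σ ≤ Real.exp (r * u) := by
    have : r * u / σ ≤ Real.exp (r * u / σ) := by linarith [Real.add_one_le_exp (r * u / σ)]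
    calc (r * u / σ) ^ σ ≤ Real.exp (r * u / σ) ^ σ :=
          Real.rpow_le_rpow (by positivity) this hσ.le
      _ = Real.exp (r * u) := by rw [← Real.exp_mul]; field_simp
  have h2 : (σ / r) ^ σ * u ^ (-σ) = ((r * u / σ) ^ σ)⁻¹ := by
    rw [← Real.inv_rpow (by positivity), Real.rpow_neg hu.le, ← Real.inv_rpow hu.le,
      ← Real.mul_rpow (by positivity) (by positivity)]
    congr 1
    field_simp
  rw [h2, Real.exp_neg]
  exact inv_anti₀ (by positivity) h1

open Complex Set MeasureTheory in
theorem integrableOn_rpow_mul_exp_neg {b r : ℝ} (hb : -1 < b) (hr : 0 < r) :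
    IntegrableOn (fun t : ℝ => t ^ b * Real.exp (-(r * t))) (Ioi 0) := by
  simpa only [Real.rpow_one, neg_mul] using
    integrableOn_rpow_mul_exp_neg_mul_rpow (s := b) (p := 1) hb one_pos hr

open Complex Set MeasureTheory Filter in
/-- The integral `∫ t ^ (s - 1) * exp (-z t)` for complex `z` in the right half-plane. -/
theorem integral_cpow_mul_cexp_neg_mul_Ioi {s z : ℂ} (hs : 0 < s.re) (hz : 0 < z.re) :
    ∫ t in Ioi (0 : ℝ), (t : ℂ) ^ (s - 1) * cexp (-(z * t)) = z ^ (-s) * Gamma s := by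
  set U : Set ℂ := {z | 0 < z.re} with hU
  have hUo : IsOpen U := isOpen_lt continuous_const continuous_re
  have hmeas : ∀ z a : ℂ, AEStronglyMeasurable
      (fun t : ℝ => (t : ℂ) ^ a * cexp (-(z * t))) (volume.restrict (Ioi 0)) := fun z a => by
    refine ContinuousOn.aestronglyMeasurable ?_ measurableSet_Ioi
    refine ContinuousOn.mul (fun t ht => ?_) (by fun_prop)
    exact (continuousAt_ofReal_cpow_const t _ (Or.inr (ne_of_gt ht))).continuousWithinAt
  have hnorm : ∀ z a : ℂ, ∀ t : ℝ, 0 < t → ‖(t : ℂ) ^ a * cexp (-(z * t))‖ =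
      t ^ a.re * Real.exp (-(z.re * t)) := fun z a t ht => by
    rw [norm_mul, norm_cpow_eq_rpow_re_of_pos ht, norm_exp, neg_re, re_mul_ofReal]
  have hderiv : DifferentiableOn ℂ
      (fun z => ∫ t in Ioi (0 : ℝ), (t : ℂ) ^ (s - 1) * cexp (-(z * t))) U := by
    intro z hz
    have hz' : 0 < z.re := hz
    refine DifferentiableAt.differentiableWithinAt ?_
    refine (hasDerivAt_integral_of_dominated_loc_of_deriv_le
      (F' := fun w t => -((t : ℂ) ^ s * cexp (-(w * t))))
      (bound := fun t => t ^ s.re * Real.exp (-(z.re / 2 * t)))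
      (Metric.ball_mem_nhds z (half_pos hz')) (Eventually.of_forall fun w => hmeas w _)
      ?_ (hmeas z s).neg ?_ (integrableOn_rpow_mul_exp_neg (by linarith) (half_pos hz'))
      ?_).2.differentiableAt
    · refine (integrableOn_rpow_mul_exp_neg (b := s.re - 1) (by linarith) hz').mono' (hmeas z _) ?_
      refine (ae_restrict_iff' measurableSet_Ioi).2 (.of_forall fun t ht => ?_)
      rw [hnorm z _ t ht, sub_re, one_re]
    · refine (ae_restrict_iff' measurableSet_Ioi).2 (.of_forall fun t ht w hw => ?_)
      have ht' : 0 < t := ht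
      have hw' : z.re / 2 ≤ w.re := by
        have h1 := (abs_re_le_norm (w - z)).trans (mem_ball_iff_norm.1 hw).le
        rw [sub_re] at h1
        linarith [(abs_le.1 h1).1]
      rw [norm_neg, hnorm w _ t ht]
      gcongr
    · refine (ae_restrict_iff' measurableSet_Ioi).2 (.of_forall fun t ht w hw => ?_)
      have ht0 : (t : ℂ) ≠ 0 := ofReal_ne_zero.2 (ne_of_gt ht)
      have h1 : HasDerivAt (fun w : ℂ => (t : ℂ) ^ (s - 1) * cexp (-(w * t)))
          ((t : ℂ) ^ (s - 1) * (cexp (-(w * t)) * -(1 * t))) w :=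
        (((hasDerivAt_id w).mul_const (t : ℂ)).neg.cexp).const_mul _
      convert! h1 using 1
      rw [cpow_sub _ _ ht0, cpow_one]
      field_simp
  have hright : DifferentiableOn ℂ (fun z : ℂ => z ^ (-s) * Gamma s) U := fun z hz => by
    refine DifferentiableAt.differentiableWithinAt (DifferentiableAt.mul_const ?_ _)
    exact differentiableAt_id.cpow_const (Or.inl hz)
  have hone : (1 : ℂ) ∈ U := by simp [hU]
  have hreal : ∀ r : ℝ, 0 < r → ∫ t in Ioi (0 : ℝ), (t : ℂ) ^ (s - 1) * cexp (-((r : ℂ) * t)) =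
      (r : ℂ) ^ (-s) * Gamma s := fun r hr => by
    rw [integral_cpow_mul_exp_neg_mul_Ioi hs hr, one_div, inv_cpow _ _
      (by rw [arg_ofReal_of_nonneg hr.le]; exact Real.pi_pos.ne), cpow_neg]
  -- Both sides are holomorphic in `z` on the right half-plane and agree at positive reals, which
  -- accumulate at `1`: the identity theorem applies.
  refine (hderiv.analyticOnNhd hUo).eqOn_of_preconnected_of_frequently_eq
    (hright.analyticOnNhd hUo) (convex_halfSpace_re_gt 0).isPreconnected hone ?_ hz
  have ht : Tendsto (fun r : ℝ => (r : ℂ)) (𝓝[≠] 1) (𝓝[≠] 1) := by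
    refine tendsto_nhdsWithin_of_tendsto_nhds_of_eventually_within _
      ((continuous_ofReal.tendsto' 1 1 (by simp)).mono_left nhdsWithin_le_nhds) ?_
    filter_upwards [self_mem_nhdsWithin] with r hr
    simpa using hr
  refine ht.frequently (Eventually.frequently ?_)
  have : ∀ᶠ r : ℝ in 𝓝[≠] 1, 0 < r := nhdsWithin_le_nhds (Ioi_mem_nhds one_pos)
  filter_upwards [this] with r hr using hreal r hr

/-- The series `∑ i, a i * exp (-P i * ω * t)`. -/
noncomputable def expSeries {ι : Type*} (a : ι → ℂ) (P : ι → ℝ) (ω : ℂ) (t : ℝ) : ℂ :=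
  ∑' i, a i * Complex.exp (-(P i * ω * t))

section expSeries

variable {ι : Type*} {a : ι → ℂ} {P : ι → ℝ} {ω : ℂ} {σ : ℝ}

/-- Trading the exponential for the power `-σ` separates `t` from `i`: whenever the Dirichlet series
converges at `σ`, the exponential series converges and is `O(t ^ (-σ))` on all of `(0, ∞)`. -/
theorem norm_expSeries_term_le (hP : ∀ i, 0 < P i) (hω : 0 < ω.re) (hσ : 0 < σ) {t : ℝ}
    (ht : 0 < t) (i : ι) : ‖a i * Complex.exp (-(P i * ω * t))‖ ≤
      (σ / ω.re) ^ σ * t ^ (-σ) * (‖a i‖ * P i ^ (-σ)) := by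
  have h1 : (-(P i * ω * t) : ℂ).re = -(ω.re * (P i * t)) := by
    rw [Complex.neg_re, Complex.re_mul_ofReal, Complex.re_ofReal_mul]; ring
  rw [norm_mul, Complex.norm_exp, h1]
  calc ‖a i‖ * Real.exp (-(ω.re * (P i * t)))
      ≤ ‖a i‖ * ((σ / ω.re) ^ σ * (P i * t) ^ (-σ)) := by
        gcongr
        exact Real.exp_neg_mul_le_rpow hω hσ (mul_pos (hP i) ht)
    _ = _ := by rw [Real.mul_rpow (hP i).le ht.le]; ring

theorem summable_expSeries (hP : ∀ i, 0 < P i) (hω : 0 < ω.re) (hσ : 0 < σ)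
    (hs : Summable fun i => ‖a i‖ * P i ^ (-σ)) {t : ℝ} (ht : 0 < t) :
    Summable fun i => a i * Complex.exp (-(P i * ω * t)) :=
  (hs.mul_left _).of_norm_bounded fun i => norm_expSeries_term_le hP hω hσ ht i

theorem exists_norm_expSeries_le (hP : ∀ i, 0 < P i) (hω : 0 < ω.re) (hσ : 0 < σ)
    (hs : Summable fun i => ‖a i‖ * P i ^ (-σ)) :
    ∃ C, ∀ t, 0 < t → ‖expSeries a P ω t‖ ≤ C * t ^ (-σ) := by
  refine ⟨(σ / ω.re) ^ σ * ∑' i, ‖a i‖ * P i ^ (-σ), fun t ht => ?_⟩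
  have := tsum_of_norm_bounded (hs.hasSum.mul_left ((σ / ω.re) ^ σ * t ^ (-σ)))
    fun i => norm_expSeries_term_le (a := a) hP hω hσ ht i
  refine this.trans (le_of_eq (by ring))

theorem continuousOn_expSeries (hP : ∀ i, 0 < P i) (hω : 0 < ω.re) (hσ : 0 < σ)
    (hs : Summable fun i => ‖a i‖ * P i ^ (-σ)) :
    ContinuousOn (expSeries a P ω) (Set.Ioi 0) := by
  intro t ht
  have ht' : (0 : ℝ) < t := ht
  refine ContinuousAt.continuousWithinAt ?_
  have h : ContinuousOn (expSeries a P ω) (Set.Ioi (t / 2)) := by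
    refine continuousOn_tsum (fun i => by fun_prop)
      (hs.mul_left ((σ / ω.re) ^ σ * (t / 2) ^ (-σ))) fun i y hy => ?_
    have hy' : t / 2 < y := hy
    refine (norm_expSeries_term_le hP hω hσ ((half_pos ht').trans hy') i).trans ?_
    have h1 : y ^ (-σ) ≤ (t / 2) ^ (-σ) :=
      Real.rpow_le_rpow_of_nonpos (half_pos ht') hy'.le (by linarith)
    have h2 := Real.rpow_nonneg (hP i).le (-σ)
    have h3 : 0 ≤ (σ / ω.re) ^ σ := by positivity
    gcongr
  exact h.continuousAt (Ioi_mem_nhds (half_lt_self ht'))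

open Complex Set MeasureTheory in
-- Termwise integration: in absolute value the terms integrate to a constant times `‖a i‖ * P i ^
-- (-s.re)`. Since `P i > 0`, the power of `P i * ω` splits without a branch correction.
theorem hasSum_mellin_expSeries [Countable ι] (hP : ∀ i, 0 < P i) (hω : 0 < ω.re) {s : ℂ}
    (hs0 : 0 < s.re) (hs : Summable fun i => ‖a i‖ * P i ^ (-s.re)) :
    HasSum (fun i => Gamma s * ω ^ (-s) * (a i * (P i : ℂ) ^ (-s)))
      (mellin (expSeries a P ω) s) := by
  have hω0 : ω ≠ 0 := fun h => by simp [h] at hω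
  have hre : ∀ i, ((P i : ℂ) * ω).re = P i * ω.re := fun i => re_ofReal_mul _ _
  have hrepos : ∀ i, 0 < ((P i : ℂ) * ω).re := fun i => by rw [hre]; exact mul_pos (hP i) hω
  have hnorm : ∀ i, ∀ t : ℝ, 0 < t → ‖(t : ℂ) ^ (s - 1) * (a i * cexp (-(P i * ω * t)))‖ =
      ‖a i‖ * (t ^ (s.re - 1) * Real.exp (-(P i * ω.re * t))) := fun i t ht => by
    rw [norm_mul, norm_mul, norm_cpow_eq_rpow_re_of_pos ht, norm_exp, neg_re, re_mul_ofReal, hre,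
      sub_re, one_re]
    ring
  have hint : ∀ i, IntegrableOn (fun t : ℝ => t ^ (s.re - 1) * Real.exp (-(P i * ω.re * t)))
      (Ioi 0) := fun i => integrableOn_rpow_mul_exp_neg (by linarith) (mul_pos (hP i) hω)
  have hval : ∀ i, ∫ t in Ioi (0 : ℝ), t ^ (s.re - 1) * Real.exp (-(P i * ω.re * t)) =
      (1 / (P i * ω.re)) ^ s.re * Real.Gamma s.re := fun i =>
    Real.integral_rpow_mul_exp_neg_mul_Ioi hs0 (mul_pos (hP i) hω)
  have hterm : ∀ i, ∫ t in Ioi (0 : ℝ), (t : ℂ) ^ (s - 1) * (a i * cexp (-(P i * ω * t))) =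
      Gamma s * ω ^ (-s) * (a i * (P i : ℂ) ^ (-s)) := fun i => by
    have h1 : ∀ t : ℝ, (t : ℂ) ^ (s - 1) * (a i * cexp (-(P i * ω * t))) =
        a i * ((t : ℂ) ^ (s - 1) * cexp (-(P i * ω * t))) := fun t => by ring
    simp only [h1]
    rw [integral_const_mul, integral_cpow_mul_cexp_neg_mul_Ioi hs0 (hrepos i)]
    have h2 : ((P i : ℂ) * ω) ^ (-s) = (P i : ℂ) ^ (-s) * ω ^ (-s) := by
      have hPi : (P i : ℂ) ≠ 0 := ofReal_ne_zero.2 (hP i).ne'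
      rw [cpow_def_of_ne_zero (mul_ne_zero hPi hω0), cpow_def_of_ne_zero hPi,
        cpow_def_of_ne_zero hω0, log_ofReal_mul (hP i) hω0, ← exp_add, ofReal_log (hP i).le]
      ring_nf
    rw [h2]
    ring
  have hmeas : ∀ i, AEStronglyMeasurable
      (fun t : ℝ => (t : ℂ) ^ (s - 1) * (a i * cexp (-(P i * ω * t)))) (volume.restrict (Ioi 0)) :=
    fun i => by
      refine ContinuousOn.aestronglyMeasurable ?_ measurableSet_Ioi
      refine ContinuousOn.mul (fun t ht => ?_) (by fun_prop)
      exact (continuousAt_ofReal_cpow_const t _ (Or.inr (ne_of_gt ht))).continuousWithinAt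
  have key := hasSum_integral_of_summable_integral_norm (μ := volume.restrict (Ioi (0 : ℝ)))
    (F := fun i t => (t : ℂ) ^ (s - 1) * (a i * cexp (-(P i * ω * t)))) (fun i => by
      refine ((hint i).const_mul ‖a i‖).mono' (hmeas i) ?_
      exact (ae_restrict_iff' measurableSet_Ioi).2 (.of_forall fun t ht => (hnorm i t ht).le)) (by
      have h1 : ∀ i, ∫ t in Ioi (0 : ℝ), ‖(t : ℂ) ^ (s - 1) * (a i * cexp (-(P i * ω * t)))‖ =
          (ω.re ^ (-s.re) * Real.Gamma s.re) * (‖a i‖ * P i ^ (-s.re)) := fun i => by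
        rw [setIntegral_congr_fun measurableSet_Ioi fun t ht => hnorm i t ht, integral_const_mul,
          hval, one_div, Real.inv_rpow (mul_pos (hP i) hω).le,
          ← Real.rpow_neg (mul_pos (hP i) hω).le, Real.mul_rpow (hP i).le hω.le]
        ring
      simp only [h1]
      exact hs.mul_left _)
  simp only [hterm] at key
  convert! key using 1
  rw [mellin]
  congr 1 with t
  rw [expSeries, smul_eq_mul, tsum_mul_left]

end expSeries

/-! ### Exponential growth on vertical strips -/

open Complex Set MeasureTheory in
-- Between two abscissas, `t ^ (re s - 1)` is at most the sum of its values at the ends.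
theorem exists_norm_mellin_le {f : ℝ → ℂ} {a b : ℝ} (ha : MellinConvergent f a)
    (hb : MellinConvergent f b) :
    ∃ C, ∀ s : ℂ, a ≤ s.re → s.re ≤ b → ‖mellin f s‖ ≤ C := by
  refine ⟨∫ t in Ioi (0 : ℝ), (‖(t : ℂ) ^ ((a : ℂ) - 1) • f t‖ + ‖(t : ℂ) ^ ((b : ℂ) - 1) • f t‖),
    fun s h1 h2 => norm_integral_le_of_norm_le (ha.norm.add hb.norm) ?_⟩
  refine (ae_restrict_iff' measurableSet_Ioi).2 (.of_forall fun t ht => ?_)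
  have ht' : 0 < t := ht
  simp only [norm_smul, norm_cpow_eq_rpow_re_of_pos ht', sub_re, one_re, ofReal_re]
  rw [← add_mul]
  refine mul_le_mul_of_nonneg_right ?_ (norm_nonneg _)
  rcases le_total 1 t with h | h
  · exact (Real.rpow_le_rpow_of_exponent_le h (by linarith)).trans
      (le_add_of_nonneg_left (Real.rpow_nonneg ht'.le _))
  · exact (Real.rpow_le_rpow_of_exponent_ge ht' h (by linarith)).trans
      (le_add_of_nonneg_right (Real.rpow_nonneg ht'.le _))

/-- `f` is of exponential type in `|im s|` on every vertical strip, away from the real axis. -/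
def ExpTypeOnStrips (f : ℂ → ℂ) : Prop :=
  ∀ K δ : ℝ, 0 < δ → ∃ A B : ℝ, ∀ s : ℂ, |s.re| ≤ K → δ ≤ |s.im| →
    ‖f s‖ ≤ A * Real.exp (B * |s.im|)

namespace ExpTypeOnStrips

open Complex

variable {f g : ℂ → ℂ}

theorem exists_nonneg (hf : ExpTypeOnStrips f) (K : ℝ) {δ : ℝ} (hδ : 0 < δ) :
    ∃ A B : ℝ, 0 ≤ A ∧ 0 ≤ B ∧ ∀ s : ℂ, |s.re| ≤ K → δ ≤ |s.im| →
      ‖f s‖ ≤ A * Real.exp (B * |s.im|) := by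
  obtain ⟨A, B, h⟩ := hf K δ hδ
  refine ⟨|A|, |B|, abs_nonneg _, abs_nonneg _, fun s h1 h2 => (h s h1 h2).trans ?_⟩
  gcongr
  · exact le_abs_self A
  · exact le_abs_self B

theorem of_bounded (h : ∀ K δ : ℝ, 0 < δ → ∃ C, ∀ s : ℂ, |s.re| ≤ K → δ ≤ |s.im| → ‖f s‖ ≤ C) :
    ExpTypeOnStrips f := fun K δ hδ => by
  obtain ⟨C, hC⟩ := h K δ hδ
  exact ⟨C, 0, fun s h1 h2 => by simpa using hC s h1 h2⟩

theorem const (c : ℂ) : ExpTypeOnStrips fun _ => c :=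
  of_bounded fun _ _ _ => ⟨‖c‖, fun _ _ _ => le_rfl⟩

theorem mul (hf : ExpTypeOnStrips f) (hg : ExpTypeOnStrips g) :
    ExpTypeOnStrips fun s => f s * g s := fun K δ hδ => by
  obtain ⟨A, B, hA, hB, h⟩ := hf.exists_nonneg K hδ
  obtain ⟨A', B', hA', hB', h'⟩ := hg.exists_nonneg K hδ
  refine ⟨A * A', B + B', fun s h1 h2 => ?_⟩
  rw [norm_mul, add_mul, Real.exp_add]
  calc _ ≤ (A * Real.exp (B * |s.im|)) * (A' * Real.exp (B' * |s.im|)) := by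
        gcongr
        · exact h s h1 h2
        · exact h' s h1 h2
    _ = _ := by ring

theorem add (hf : ExpTypeOnStrips f) (hg : ExpTypeOnStrips g) :
    ExpTypeOnStrips fun s => f s + g s := fun K δ hδ => by
  obtain ⟨A, B, hA, hB, h⟩ := hf.exists_nonneg K hδ
  obtain ⟨A', B', hA', hB', h'⟩ := hg.exists_nonneg K hδ
  refine ⟨A + A', B + B', fun s h1 h2 => (norm_add_le _ _).trans ?_⟩
  rw [add_mul]
  refine add_le_add ((h s h1 h2).trans ?_) ((h' s h1 h2).trans ?_)
  · gcongr; linarith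
  · gcongr; linarith

theorem sum {ι : Type*} (S : Finset ι) {F : ι → ℂ → ℂ} (h : ∀ i ∈ S, ExpTypeOnStrips (F i)) :
    ExpTypeOnStrips fun s => ∑ i ∈ S, F i s := by
  classical
  induction S using Finset.induction_on with
  | empty => simpa using const 0
  | insert i S hi ih =>
    simp only [Finset.sum_insert hi]
    exact (h i (Finset.mem_insert_self _ _)).add
      (ih fun j hj => h j (Finset.mem_insert_of_mem hj))

theorem congr (hf : ExpTypeOnStrips f) (h : ∀ s : ℂ, s.im ≠ 0 → g s = f s) :
    ExpTypeOnStrips g := fun K δ hδ => by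
  obtain ⟨A, B, hAB⟩ := hf K δ hδ
  refine ⟨A, B, fun s h1 h2 => ?_⟩
  rw [h s (abs_pos.1 (hδ.trans_le h2))]
  exact hAB s h1 h2

theorem comp_affine (hf : ExpTypeOnStrips f) {a : ℝ} (ha : a ≠ 0) (b : ℝ) :
    ExpTypeOnStrips fun s => f (a * s + b) := fun K δ hδ => by
  obtain ⟨A, B, h⟩ := hf (|a| * K + |b|) (|a| * δ) (mul_pos (abs_pos.2 ha) hδ)
  refine ⟨A, B * |a|, fun s h1 h2 => ?_⟩
  have him : (a * s + b : ℂ).im = a * s.im := by simp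
  have hre : (a * s + b : ℂ).re = a * s.re + b := by simp
  have := h (a * s + b) (by
    rw [hre]
    exact (abs_add_le _ _).trans (by rw [abs_mul]; gcongr)) (by rw [him, abs_mul]; gcongr)
  rwa [him, abs_mul, ← mul_assoc] at this

theorem cexp_mul (a : ℂ) : ExpTypeOnStrips fun s => cexp (a * s) := fun K δ _ => by
  refine ⟨Real.exp (‖a‖ * K), ‖a‖, fun s h1 _ => ?_⟩
  rw [norm_exp, ← Real.exp_add, Real.exp_le_exp, ← mul_add]
  calc (a * s).re ≤ ‖a * s‖ := re_le_norm _
    _ = ‖a‖ * ‖s‖ := norm_mul _ _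
    _ ≤ ‖a‖ * (K + |s.im|) := by
      gcongr
      exact (norm_le_abs_re_add_abs_im s).trans (by gcongr)

theorem const_cpow {c : ℂ} (hc : c ≠ 0) : ExpTypeOnStrips fun s => c ^ s :=
  (cexp_mul (Complex.log c)).congr fun s _ => by rw [cpow_def_of_ne_zero hc]

theorem inv_id : ExpTypeOnStrips fun s => s⁻¹ := of_bounded fun K δ hδ =>
  ⟨δ⁻¹, fun s _ h2 => by
    rw [norm_inv]
    exact inv_anti₀ hδ (h2.trans (abs_im_le_norm s))⟩

theorem sin_mul (a : ℂ) : ExpTypeOnStrips fun s => sin (a * s) := by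
  refine (((cexp_mul (-a * I)).add ((const (-1)).mul (cexp_mul (a * I)))).mul (const (I / 2))).congr
    fun s _ => ?_
  rw [sin]
  ring_nf

/-- `Γ` is even bounded there: for `re s ≥ 1` as a Mellin transform, and then leftwards by `Γ(s) =
Γ(s + 1) / s`, each step costing at most a factor `1 / δ`. -/
theorem Gamma : ExpTypeOnStrips Complex.Gamma := by
  have h1 : ∀ K : ℝ, ∃ C, ∀ s : ℂ, 1 ≤ s.re → s.re ≤ K → ‖Complex.Gamma s‖ ≤ C := fun K => by
    have hconv : ∀ r : ℝ, 0 < r → MellinConvergent (fun t : ℝ => (Real.exp (-t) : ℂ)) r := by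
      intro r hr
      have := Complex.GammaIntegral_convergent (s := (r : ℂ)) (by simpa using hr)
      simpa only [MellinConvergent, smul_eq_mul, mul_comm] using this
    obtain ⟨C, hC⟩ := exists_norm_mellin_le (hconv 1 one_pos)
      (hconv (max 1 K) (lt_of_lt_of_le one_pos (le_max_left _ _)))
    refine ⟨C, fun s h1 h2 => ?_⟩
    rw [Complex.Gamma_eq_integral (by linarith), Complex.GammaIntegral_eq_mellin]
    exact hC s (by simpa using h1) (by simpa using h2.trans (le_max_right _ _))
  have h2 : ∀ n : ℕ, ∀ K δ : ℝ, 0 < δ → ∃ C, ∀ s : ℂ, 1 - n ≤ s.re → s.re ≤ K → δ ≤ |s.im| →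
      ‖Complex.Gamma s‖ ≤ C := by
    intro n
    induction n with
    | zero =>
      intro K δ _
      obtain ⟨C, hC⟩ := h1 K
      exact ⟨C, fun s h h' _ => hC s (by simpa using h) h'⟩
    | succ n ih =>
      intro K δ hδ
      obtain ⟨C, hC⟩ := ih (K + 1) δ hδ
      refine ⟨C / δ, fun s h h' h'' => ?_⟩
      have hs : s ≠ 0 := by
        rintro rfl
        simp only [zero_im, abs_zero] at h''
        linarith
      have hb := hC (s + 1) (by push_cast at h; simp; linarith) (by simpa using h') (by simpa using h'')
      rw [Complex.Gamma_add_one s hs, norm_mul] at hb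
      rw [le_div_iff₀ hδ, mul_comm]
      exact (mul_le_mul_of_nonneg_right (h''.trans (abs_im_le_norm s)) (norm_nonneg _)).trans hb
  refine of_bounded fun K δ hδ => ?_
  obtain ⟨n, hn⟩ := exists_nat_ge (K + 1)
  obtain ⟨C, hC⟩ := h2 n K δ hδ
  exact ⟨C, fun s h h' => hC s (by linarith [(abs_le.1 h).1]) (abs_le.1 h).2 h'⟩

/-- By reflection `1 / Γ(s) = sin(πs) Γ(1 - s) / π`; the sine is the source of the exponential
growth. -/
theorem inv_Gamma : ExpTypeOnStrips fun s => (Complex.Gamma s)⁻¹ := by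
  have h1 := ((sin_mul (Real.pi : ℂ)).mul (Gamma.comp_affine (a := -1) (by norm_num) 1)).mul
    (const (Real.pi : ℂ)⁻¹)
  refine h1.congr fun s hs => ?_
  have hsin : sin (Real.pi * s) ≠ 0 := by
    rw [sin_ne_zero_iff]
    intro k hk
    have := congrArg Complex.im hk
    simp [Real.pi_ne_zero, hs] at this
  have hpi : (Real.pi : ℂ) ≠ 0 := ofReal_ne_zero.2 Real.pi_ne_zero
  have h2 := Complex.Gamma_mul_Gamma_one_sub s
  have h3 : ((-1 : ℝ) : ℂ) * s + (1 : ℝ) = 1 - s := by push_cast; ring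
  rw [eq_div_iff hsin] at h2
  rw [h3]
  have hG : Complex.Gamma s ≠ 0 := by
    intro h
    rw [h, zero_mul, zero_mul] at h2
    exact hpi h2.symm
  have h4 : sin (Real.pi * s) * Complex.Gamma (1 - s) * (Real.pi : ℂ)⁻¹ * Complex.Gamma s =
      Complex.Gamma s * Complex.Gamma (1 - s) * sin (Real.pi * s) * (Real.pi : ℂ)⁻¹ := by ring
  rw [inv_eq_one_div, div_eq_iff hG, h4, h2, mul_inv_cancel₀ hpi]

theorem inv_Gammaℝ : ExpTypeOnStrips fun s => (Complex.Gammaℝ s)⁻¹ := by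
  have hpi : (Real.pi : ℂ) ≠ 0 := ofReal_ne_zero.2 Real.pi_ne_zero
  have h1 := ((const_cpow hpi).comp_affine (a := 1 / 2) (by norm_num) 0).mul
    (inv_Gamma.comp_affine (a := 1 / 2) (by norm_num) 0)
  refine h1.congr fun s _ => ?_
  rw [Gammaℝ_def, mul_inv, ← cpow_neg]
  push_cast
  ring_nf

/-- `Λ₀` is a Mellin transform that converges for every `s`, hence bounded on vertical strips; `Λ`
differs from it only by two simple poles on the real axis. This is how the growth of Hurwitz zeta
and of `L` is controlled. -/
theorem weakFEPair_Λ₀ (P : WeakFEPair ℂ) : ExpTypeOnStrips P.Λ₀ := of_bounded fun K δ _ => by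
  have h : ∀ s, MellinConvergent P.f_modif s := fun s =>
    (P.isStrongFEPair_toStrongFEPair.hasMellin s).1
  obtain ⟨C, hC⟩ := exists_norm_mellin_le (h (-K : ℝ)) (h K)
  exact ⟨C, fun s hs _ => hC s (abs_le.1 hs).1 (abs_le.1 hs).2⟩

theorem weakFEPair_Λ (P : WeakFEPair ℂ) : ExpTypeOnStrips P.Λ := by
  have h1 := ((weakFEPair_Λ₀ P).add (inv_id.mul (const (-P.f₀)))).add
    ((inv_id.comp_affine (a := -1) (by norm_num) P.k).mul (const (-(P.ε * P.g₀))))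
  refine h1.congr fun s _ => ?_
  simp only [WeakFEPair.Λ, smul_eq_mul]
  push_cast
  ring_nf

theorem hurwitzZeta (a : UnitAddCircle) : ExpTypeOnStrips (HurwitzZeta.hurwitzZeta a) := by
  have h1 := (((weakFEPair_Λ (HurwitzZeta.hurwitzEvenFEPair a)).comp_affine (a := 1 / 2)
    (by norm_num) 0).mul (const (1 / 2))).mul inv_Gammaℝ
  have h2 := (((weakFEPair_Λ (HurwitzZeta.hurwitzOddFEPair a)).comp_affine (a := 1 / 2)
    (by norm_num) (1 / 2)).mul (const (1 / 2))).mul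
    (inv_Gammaℝ.comp_affine (a := 1) one_ne_zero 1)
  refine (h1.add h2).congr fun s hs => ?_
  have hs0 : s ≠ 0 := by rintro rfl; exact hs rfl
  rw [HurwitzZeta.hurwitzZeta, HurwitzZeta.hurwitzZetaEven_def_of_ne_or_ne (Or.inr hs0),
    HurwitzZeta.hurwitzZetaOdd, HurwitzZeta.completedHurwitzZetaEven,
    HurwitzZeta.completedHurwitzZetaOdd]
  push_cast
  simp only [div_eq_mul_inv]
  ring_nf

theorem LFunction {q : ℕ} [NeZero q] (Φ : ZMod q → ℂ) : ExpTypeOnStrips (ZMod.LFunction Φ) := by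
  have hq : (q : ℂ) ≠ 0 := Nat.cast_ne_zero.2 (NeZero.ne q)
  have h1 := ((const_cpow hq).comp_affine (a := -1) (by norm_num) 0).mul
    (sum Finset.univ fun j _ => (const (Φ j)).mul (hurwitzZeta (ZMod.toAddCircle j)))
  refine h1.congr fun s _ => ?_
  rw [ZMod.LFunction]
  push_cast
  ring_nf

theorem riemannZeta : ExpTypeOnStrips _root_.riemannZeta := by
  rw [← HurwitzZeta.hurwitzZeta_zero]
  exact hurwitzZeta 0

end ExpTypeOnStrips

/-! ### Generalized Bernoulli numbers and values of `L` at negative integers -/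

theorem sum_zmod_eq_sum_Icc {q : ℕ} [NeZero q] (f : ZMod q → ℂ) :
    ∑ a, f a = ∑ r ∈ Finset.Icc 1 q, f (r : ZMod q) := by
  have h1 : ∑ r ∈ Finset.Icc 1 q, f (r : ZMod q) =
      ∑ r ∈ Finset.range q, f ((r : ZMod q) + 1) := by
    have h := Finset.sum_Ico_add' (fun r : ℕ => f (r : ZMod q)) 0 q 1
    simp only [Nat.cast_add, Nat.cast_one, zero_add] at h
    rw [Finset.range_eq_Ico, h, ← Finset.Ico_succ_right_eq_Icc]
    rfl
  have h2 : ∑ r ∈ Finset.range q, f ((r : ZMod q) + 1) = ∑ a : ZMod q, f (a + 1) :=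
    Finset.sum_nbij' (fun r => (r : ZMod q)) ZMod.val (by simp)
      (fun a _ => Finset.mem_range.2 (ZMod.val_lt a))
      (fun r hr => ZMod.val_natCast_of_lt (Finset.mem_range.1 hr)) (by simp) (by simp)
  rw [h1, h2]
  exact (Equiv.sum_comp (Equiv.addRight (1 : ZMod q)) f).symm

open PowerSeries in
-- After multiplication by the nonzero series `e^{qt} - 1`, each term is the generating function of
-- the Bernoulli polynomials at `r / q`, rescaled by `q`.
theorem bernoulliCharSeries_eq {q : ℕ} [NeZero q] (χ : DirichletCharacter ℂ q) :
    bernoulliCharSeries χ = ∑ r ∈ Finset.Icc 1 q, C (χ (r : ZMod q) * (q : ℂ)⁻¹) *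
      rescale (q : ℂ) (mk fun n => Polynomial.aeval ((r : ℂ) / q)
        ((1 / (n.factorial : ℚ)) • Polynomial.bernoulli n)) := by
  have hq : (q : ℂ) ≠ 0 := Nat.cast_ne_zero.2 (NeZero.ne q)
  have hne : rescale (q : ℂ) (exp ℂ) - 1 ≠ 0 := by
    intro h
    have := congrArg (coeff 1) h
    simp [coeff_rescale, coeff_exp, coeff_one, hq] at this
  refine mul_right_cancel₀ hne ?_
  rw [bernoulliCharSeries_mul, Finset.sum_mul]
  refine Finset.sum_congr rfl fun r _ => ?_
  have h1 := congrArg (rescale (q : ℂ)) (Polynomial.bernoulli_generating_function ((r : ℂ) / q))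
  rw [map_mul, map_sub, map_one, map_mul, rescale_X, rescale_rescale,
    div_mul_cancel₀ _ hq] at h1
  rw [mul_assoc, h1, map_mul, mul_assoc, ← mul_assoc (C (q : ℂ)⁻¹), ← mul_assoc (C (q : ℂ)⁻¹),
    ← map_mul, inv_mul_cancel₀ hq, map_one, one_mul]

theorem bernoulliChar_eq {q : ℕ} [NeZero q] (χ : DirichletCharacter ℂ q) (n : ℕ) :
    bernoulliChar n χ = ∑ r ∈ Finset.Icc 1 q, χ (r : ZMod q) * ((q : ℂ)⁻¹ * (q : ℂ) ^ n) *
      ((Polynomial.bernoulli n).map (algebraMap ℚ ℂ)).eval ((r : ℂ) / q) := by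
  have hn : (n.factorial : ℂ) ≠ 0 := Nat.cast_ne_zero.2 n.factorial_ne_zero
  rw [bernoulliChar, bernoulliCharSeries_eq, map_sum, Finset.mul_sum]
  refine Finset.sum_congr rfl fun r _ => ?_
  rw [PowerSeries.coeff_C_mul, PowerSeries.coeff_rescale, PowerSeries.coeff_mk, map_smul,
    Polynomial.aeval_def, Polynomial.eval_map, Algebra.smul_def]
  simp only [one_div, map_inv₀, map_natCast]
  field_simp

/-- Values of a Dirichlet `L`-function at negative integers. -/
theorem LFunction_neg_nat {q : ℕ} [NeZero q] (χ : DirichletCharacter ℂ q) {j : ℕ} (hj : j ≠ 0) :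
    DirichletCharacter.LFunction χ (-j) = -bernoulliChar (j + 1) χ / (j + 1) := by
  have hq : (q : ℂ) ≠ 0 := Nat.cast_ne_zero.2 (NeZero.ne q)
  have hqr : (0 : ℝ) < q := Nat.cast_pos.2 (NeZero.pos q)
  rw [DirichletCharacter.LFunction, ZMod.LFunction, sum_zmod_eq_sum_Icc, bernoulliChar_eq,
    ← Finset.sum_neg_distrib, Finset.sum_div, Finset.mul_sum]
  refine Finset.sum_congr rfl fun r hr => ?_
  have hx : ((r : ℝ) / q) ∈ Set.Icc (0 : ℝ) 1 :=
    ⟨by positivity, (div_le_one hqr).2 (by exact_mod_cast (Finset.mem_Icc.1 hr).2)⟩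
  rw [ZMod.toAddCircle_natCast, HurwitzZeta.hurwitzZeta_neg_nat hj hx, neg_neg, Complex.cpow_natCast,
    pow_succ]
  push_cast
  field_simp

/-! ### Poles and residues of `Γ(s) L(s, χ) ζ(Ns - N + 2h)` -/

open Filter Complex in
theorem tendsto_add_nat_mul_Gamma (n : ℕ) :
    Tendsto (fun s : ℂ => (s + n) * Complex.Gamma s) (𝓝[≠] (-n : ℂ))
      (𝓝 ((-1) ^ n / n.factorial)) := by
  induction n with
  | zero => simpa using tendsto_self_mul_Gamma_nhds_zero
  | succ n ih =>
    have hmap : Tendsto (fun s : ℂ => s + 1) (𝓝[≠] (-(n + 1 : ℕ) : ℂ)) (𝓝[≠] (-n : ℂ)) := by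
      refine tendsto_nhdsWithin_of_tendsto_nhds_of_eventually_within _
        (Tendsto.mono_left (Continuous.tendsto' (by fun_prop) _ _ (by push_cast; ring))
          nhdsWithin_le_nhds) ?_
      filter_upwards [self_mem_nhdsWithin] with s hs h
      refine hs ?_
      rw [Set.mem_singleton_iff] at h ⊢
      push_cast
      linear_combination h
    have hne : (-(n + 1 : ℕ) : ℂ) ≠ 0 := neg_ne_zero.2 (Nat.cast_ne_zero.2 n.succ_ne_zero)
    have hinv : Tendsto (fun s : ℂ => s⁻¹) (𝓝[≠] (-(n + 1 : ℕ) : ℂ)) (𝓝 (-(n + 1 : ℕ) : ℂ)⁻¹) :=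
      (tendsto_inv₀ hne).mono_left nhdsWithin_le_nhds
    have h := (ih.comp hmap).mul hinv
    have hval : (-1 : ℂ) ^ n / n.factorial * (-(n + 1 : ℕ) : ℂ)⁻¹ =
        (-1) ^ (n + 1) / (n + 1).factorial := by
      have h1 : (n.factorial : ℂ) ≠ 0 := Nat.cast_ne_zero.2 n.factorial_ne_zero
      rw [Nat.factorial_succ]
      push_cast at hne ⊢
      have h2 : (n + 1 : ℂ) ≠ 0 := fun h => hne (by rw [h, neg_zero])
      field_simp
      ring
    rw [hval] at h
    refine h.congr' ?_
    have hev : ∀ᶠ s : ℂ in 𝓝[≠] (-(n + 1 : ℕ) : ℂ), s ≠ 0 :=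
      nhdsWithin_le_nhds (isOpen_ne.mem_nhds hne)
    filter_upwards [hev] with s hs
    simp only [Function.comp]
    rw [Complex.Gamma_add_one s hs]
    push_cast
    field_simp
    ring

open Filter Complex in
-- The integers form a closed discrete set. This avoids all the poles of `Γ` at once in a punctured
-- neighbourhood.
theorem eventually_ne_intCast (p : ℂ) : ∀ᶠ s : ℂ in 𝓝[≠] p, ∀ n : ℤ, s ≠ n := by
  have hemb : Topology.IsClosedEmbedding (fun n : ℤ => (n : ℂ)) := by
    have := Complex.isometry_ofReal.isClosedEmbedding.comp Int.isClosedEmbedding_coe_real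
    convert! this using 2
  have hcl : IsClosed ((fun n : ℤ => (n : ℂ)) '' {n | (n : ℂ) ≠ p}) :=
    hemb.isClosedMap _ (isClosed_discrete _)
  have hp : p ∈ ((fun n : ℤ => (n : ℂ)) '' {n | (n : ℂ) ≠ p})ᶜ := by
    rintro ⟨n, hn, h⟩
    exact hn h
  filter_upwards [nhdsWithin_le_nhds (hcl.isOpen_compl.mem_nhds hp), self_mem_nhdsWithin]
    with s hs hsp n hn
  exact hs ⟨n, fun h => hsp (hn.trans h), hn.symm⟩

open Filter Complex in
/-- A meromorphic function with finitely many simple poles, all real, becomes entire when its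
principal parts are subtracted. -/
theorem exists_entire_sub_residues {ι : Type*} {S : Finset ι} {p : ι → ℝ} {r : ι → ℂ} {M : ℂ → ℂ}
    (hd : ∀ z, ∀ᶠ s in 𝓝[≠] z, DifferentiableAt ℂ M s)
    (hoff : ∀ s : ℂ, s.im ≠ 0 → DifferentiableAt ℂ M s)
    (hr : ∀ z : ℂ, Tendsto (fun s => (s - z) * M s) (𝓝[≠] z)
      (𝓝 (∑ i ∈ S, if (p i : ℂ) = z then r i else 0))) :
    ∃ E : ℂ → ℂ, Differentiable ℂ E ∧
      ∀ s : ℂ, s.im ≠ 0 → E s = M s - ∑ i ∈ S, r i / (s - p i) := by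
  have hdR : ∀ s : ℂ, (∀ i ∈ S, s ≠ p i) → DifferentiableAt ℂ (fun s => ∑ i ∈ S, r i / (s - p i)) s :=
    fun s hs => DifferentiableAt.fun_sum fun i hi =>
      (differentiableAt_const _).div (by fun_prop) (sub_ne_zero.2 (hs i hi))
  have hev : ∀ z : ℂ, ∀ᶠ s : ℂ in 𝓝[≠] z, ∀ i ∈ S, s ≠ p i := fun z => by
    rw [Filter.eventually_all_finset]
    intro i _
    rcases eq_or_ne z (p i) with h | h
    · filter_upwards [self_mem_nhdsWithin] with s hs
      rwa [← h]
    · exact nhdsWithin_le_nhds (isOpen_ne.mem_nhds h)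
  obtain ⟨E, hE, hEc⟩ := exists_entire_extension (g := fun s => M s - ∑ i ∈ S, r i / (s - p i))
    (fun z => by
      filter_upwards [hd z, hev z] with s h1 h2 using h1.sub (hdR s h2))
    (fun z => by
      obtain ⟨ℓ, hℓ⟩ := exists_tendsto_sub_principal_part (hd z) (hr z)
      have h2 : Tendsto (fun s => ∑ i ∈ S, (if (p i : ℂ) = z then 0 else r i / (s - p i)))
          (𝓝[≠] z) (𝓝 (∑ i ∈ S, (if (p i : ℂ) = z then 0 else r i / (z - p i)))) := by
        refine tendsto_finsetSum _ fun i _ => ?_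
        split_ifs with h
        · exact tendsto_const_nhds
        · have : ContinuousAt (fun s : ℂ => r i / (s - p i)) z :=
            ContinuousAt.div continuousAt_const (by fun_prop) (sub_ne_zero.2 (Ne.symm h))
          exact this.tendsto.mono_left nhdsWithin_le_nhds
      refine ⟨_, (hℓ.sub h2).congr fun s => ?_⟩
      -- The locations `p i` may coincide: at `z` the principal parts of all `i` with `p i = z` are
      -- removed together, the others being regular there.
      rw [sub_sub, Finset.sum_div, ← Finset.sum_add_distrib]
      congr 1
      refine Finset.sum_congr rfl fun i _ => ?_
      split_ifs with h
      · rw [h, add_zero]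
      · rw [zero_div, zero_add])
  refine ⟨E, hE, fun s hs => hEc s ?_⟩
  refine ((hoff s hs).sub (hdR s fun i _ h => hs ?_)).continuousAt
  rw [h, ofReal_im]

section residues

open Filter Complex DirichletCharacter

variable {q : ℕ} [NeZero q] {χ : DirichletCharacter ℂ q}

theorem DirichletCharacter.IsPrimitive.ne_one (hχ : χ.IsPrimitive) (hq : q ≠ 1) : χ ≠ 1 := by
  rintro rfl
  rw [isPrimitive_def, conductor_one] at hχ
  exact hq hχ.symm

theorem tendsto_sub_one_mul_Gamma_mul_LFunction (hχ : χ.IsPrimitive) :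
    Tendsto (fun s => (s - 1) * (Complex.Gamma s * LFunction χ s)) (𝓝[≠] 1)
      (𝓝 (if q = 1 then 1 else 0)) := by
  have h1 : Tendsto Complex.Gamma (𝓝[≠] 1) (𝓝 1) := by
    have := continuousAt_Gamma_one.tendsto.mono_left (nhdsWithin_le_nhds (s := {1}ᶜ))
    rwa [Complex.Gamma_one] at this
  have h2 := h1.mul (ZMod.LFunction_residue_one χ)
  have h3 : ∑ j, χ j / q = if q = 1 then 1 else 0 := by
    split_ifs with hq
    · subst hq
      have : ∀ j : ZMod 1, χ j = 1 := fun j => by rw [Subsingleton.elim j 1, map_one]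
      simp [this]
    · rw [← Finset.sum_div, MulChar.sum_eq_zero_of_ne_one (hχ.ne_one hq), zero_div]
  rw [h3, one_mul] at h2
  exact h2.congr fun s => by rw [LFunction]; ring

theorem tendsto_add_nat_mul_Gamma_mul_LFunction (χ : DirichletCharacter ℂ q) (j : ℕ) :
    Tendsto (fun s => (s - (-j)) * (Complex.Gamma s * LFunction χ s)) (𝓝[≠] (-j : ℂ))
      (𝓝 ((-1) ^ j / j.factorial * LFunction χ (-j))) := by
  have hne : (-j : ℂ) ≠ 1 := by
    intro h
    have := congrArg re h
    simp only [neg_re, natCast_re, one_re] at this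
    linarith [(Nat.cast_nonneg j : (0 : ℝ) ≤ j)]
  have h1 : Tendsto (LFunction χ) (𝓝[≠] (-j : ℂ)) (𝓝 (LFunction χ (-j))) :=
    (differentiableAt_LFunction χ _ (Or.inl hne)).continuousAt.tendsto.mono_left nhdsWithin_le_nhds
  exact ((tendsto_add_nat_mul_Gamma j).mul h1).congr fun s => by ring

theorem differentiableAt_Gamma_mul_LFunction (χ : DirichletCharacter ℂ q) {s : ℂ} (h1 : s ≠ 1)
    (h2 : ∀ j : ℕ, s ≠ -j) :
    DifferentiableAt ℂ (fun s => Complex.Gamma s * LFunction χ s) s :=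
  (differentiableAt_Gamma s h2).mul (differentiableAt_LFunction χ s (Or.inl h1))

theorem eventually_differentiableAt_Gamma_mul_LFunction (χ : DirichletCharacter ℂ q) (z : ℂ) :
    ∀ᶠ s in 𝓝[≠] z, DifferentiableAt ℂ (fun s => Complex.Gamma s * LFunction χ s) s := by
  filter_upwards [eventually_ne_intCast z] with s hs
  exact differentiableAt_Gamma_mul_LFunction χ (by simpa using hs 1)
    fun j => by simpa using hs (-j)

variable {N : ℕ} {h : ℤ}

/-- The pole of `ζ(Ns - N + 2h)` meets a zero of `L(s, χ)` if it lies at a negative integer. -/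
theorem LFunction_eq_zero_of_zeta_pole (hNh : (N : ℤ) - 2 * h ≠ -1)
    (hparity : χ.Even ∨ (χ.Odd ∧ Even N)) {j : ℕ} (hj : (N : ℤ) - 2 * h + 1 = -(j * N)) :
    LFunction χ (-j) = 0 := by
  have hj0 : j ≠ 0 := by
    rintro rfl
    simp only [Nat.cast_zero, zero_mul, neg_zero] at hj
    omega
  -- An odd product forces `N` odd and `j` even, and `j ≠ 0` because `N - 2h ≠ -1`. So `χ` is even
  -- and `-j` is a trivial zero.
  have h1 : (N : ℤ) * (j + 1) = 2 * h - 1 := by linarith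
  have hodd : _root_.Odd ((N : ℤ) * (j + 1)) := h1 ▸ ⟨h - 1, by ring⟩
  rw [Int.odd_mul] at hodd
  rcases hparity with he | ⟨-, hNe⟩
  · obtain ⟨m, hm⟩ : _root_.Even j := by
      have h3 := hodd.2
      rw [Int.odd_iff] at h3
      rw [Nat.even_iff]
      omega
    have hm0 : m ≠ 0 := by omega
    have : NeZero m := ⟨hm0⟩
    have := he.LFunction_neg_two_mul_nat m
    rw [hm]
    push_cast
    rwa [two_mul] at this
  · exact absurd hodd.1 (Int.not_odd_iff_even.2 (by exact_mod_cast hNe))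

/-- Beyond the range of the finite sum, every residue vanishes. -/
theorem LFunction_mul_zeta_eq_zero (hN : 1 ≤ N) (hparity : χ.Even ∨ (χ.Odd ∧ Even N)) {j : ℕ}
    (hj : (2 * ⌊(h : ℝ) / (N : ℝ)⌋ + 1).toNat < j) :
    LFunction χ (-j) * riemannZeta (-(N : ℂ) * j - N + 2 * h) = 0 := by
  have hNr : (0 : ℝ) < N := by exact_mod_cast hN
  have hzeta : _root_.Even ((N : ℤ) * (j + 1)) → 2 * h < N * (j + 1) →
      riemannZeta (-(N : ℂ) * j - N + 2 * h) = 0 := by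
    rintro ⟨k, hk⟩ hlt
    obtain ⟨n, hn⟩ : ∃ n : ℕ, k - h = n + 1 := ⟨(k - h - 1).toNat, by omega⟩
    have h1 : -(N : ℂ) * j - N + 2 * h = -2 * (n + 1) := by
      have h2 : ((N : ℂ) * (j + 1)) = k + k := by exact_mod_cast hk
      have h3 : (k : ℂ) - h = n + 1 := by exact_mod_cast hn
      linear_combination -h2 - 2 * h3
    rw [h1]
    exact riemannZeta_neg_two_mul_nat_add_one n
  -- For even `χ`, an even `j` gives a trivial zero of `L`. In the remaining cases `N (j + 1)` is
  -- even, and this inequality places the argument of zeta at a negative even integer.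
  have hlt : 2 * h < N * (j + 1) := by
    have h1 : (2 * ⌊(h : ℝ) / (N : ℝ)⌋ + 1) < j := by omega
    have h2 : (h : ℝ) < (⌊(h : ℝ) / (N : ℝ)⌋ + 1) * N :=
      (div_lt_iff₀ hNr).1 (Int.lt_floor_add_one _)
    have h3 : h < (⌊(h : ℝ) / (N : ℝ)⌋ + 1) * N := by exact_mod_cast h2
    nlinarith
  have hj0 : j ≠ 0 := by omega
  rcases hparity with he | ⟨ho, hNe⟩
  · rcases Nat.even_or_odd j with ⟨m, hm⟩ | hjo
    · have hm0 : m ≠ 0 := by omega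
      have : NeZero m := ⟨hm0⟩
      have := he.LFunction_neg_two_mul_nat m
      rw [two_mul] at this
      have h2 : (j : ℂ) = m + m := by rw [hm]; push_cast; ring
      rw [h2, this, zero_mul]
    · rw [hzeta (Even.mul_left (by
        have h2 : _root_.Odd (j : ℤ) := by exact_mod_cast hjo
        exact h2.add_odd odd_one) _) hlt, mul_zero]
  · rw [hzeta (Even.mul_right (by exact_mod_cast hNe) _) hlt, mul_zero]

/-- Locations of the poles of `Γ(s) L(s, χ) ζ(Ns - N + 2h)`. -/
noncomputable def poleLoc (N : ℕ) (h : ℤ) : ℕ → ℝ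
  | 0 => 1
  | 1 => ((N : ℝ) - 2 * h + 1) / N
  | j + 2 => -j

/-- The corresponding residues; `ℓ` stands for `Γ(s) L(s, χ)` at the pole of zeta. -/
noncomputable def poleRes (χ : DirichletCharacter ℂ q) (N : ℕ) (h : ℤ) (ℓ : ℂ) : ℕ → ℂ
  | 0 => if q = 1 then riemannZeta (2 * h) else 0
  | 1 => ℓ / N
  | j + 2 => (-1) ^ j / j.factorial * LFunction χ (-j) * riemannZeta (-(N : ℂ) * j - N + 2 * h)

/-- If the point is a pole `-j` of `Γ`, the zero of `L` there makes the principal part vanish. It is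
never the possible pole `1` of `L`, since `2h ≠ 1`. -/
theorem exists_tendsto_Gamma_mul_LFunction (hN : 1 ≤ N) (hNh : (N : ℤ) - 2 * h ≠ -1)
    (hparity : χ.Even ∨ (χ.Odd ∧ Even N)) :
    ∃ ℓ, Tendsto (fun s => Complex.Gamma s * LFunction χ s)
      (𝓝[≠] (((N : ℂ) - 2 * h + 1) / N)) (𝓝 ℓ) := by
  have hN0 : (N : ℂ) ≠ 0 := Nat.cast_ne_zero.2 (by omega)
  by_cases hj : ∃ j : ℕ, ((N : ℂ) - 2 * h + 1) / N = -j
  · obtain ⟨j, hj⟩ := hj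
    rw [hj]
    have h1 := tendsto_add_nat_mul_Gamma_mul_LFunction χ j
    rw [div_eq_iff hN0] at hj
    rw [LFunction_eq_zero_of_zeta_pole hNh hparity (j := j) (by
      rw [neg_mul] at hj; exact_mod_cast hj), mul_zero] at h1
    obtain ⟨ℓ, hℓ⟩ := exists_tendsto_sub_principal_part
      (eventually_differentiableAt_Gamma_mul_LFunction χ _) h1
    exact ⟨ℓ, hℓ.congr fun s => by simp⟩
  · push Not at hj
    refine ⟨_, (differentiableAt_Gamma_mul_LFunction χ ?_ hj).continuousAt.tendsto.mono_left
      nhdsWithin_le_nhds⟩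
    intro h1
    rw [div_eq_one_iff_eq hN0] at h1
    have h2 : (N : ℤ) - 2 * h + 1 = N := by exact_mod_cast h1
    omega

theorem differentiableAt_zeta_affine {s : ℂ} (hN : 1 ≤ N) (hs : s ≠ ((N : ℂ) - 2 * h + 1) / N) :
    DifferentiableAt ℂ (fun s : ℂ => riemannZeta (N * s - N + 2 * h)) s := by
  have hN0 : (N : ℂ) ≠ 0 := Nat.cast_ne_zero.2 (by omega)
  have h1 : (N : ℂ) * s - N + 2 * h ≠ 1 := by
    intro h1
    refine hs ?_
    rw [eq_div_iff hN0]
    linear_combination h1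
  exact (differentiableAt_riemannZeta h1).comp s (by fun_prop :
    DifferentiableAt ℂ (fun s : ℂ => (N : ℂ) * s - N + 2 * h) s)

theorem tendsto_sub_mul_zeta_affine (hN : 1 ≤ N) :
    Tendsto (fun s : ℂ => (s - ((N : ℂ) - 2 * h + 1) / N) * riemannZeta (N * s - N + 2 * h))
      (𝓝[≠] (((N : ℂ) - 2 * h + 1) / N)) (𝓝 (1 / N)) := by
  have hN0 : (N : ℂ) ≠ 0 := Nat.cast_ne_zero.2 (by omega)
  have hmap : Tendsto (fun s : ℂ => N * s - N + 2 * h) (𝓝[≠] (((N : ℂ) - 2 * h + 1) / N))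
      (𝓝[≠] 1) := by
    refine tendsto_nhdsWithin_of_tendsto_nhds_of_eventually_within _
      (Tendsto.mono_left (Continuous.tendsto' (by fun_prop) _ _ (by field_simp; ring))
        nhdsWithin_le_nhds) ?_
    filter_upwards [self_mem_nhdsWithin] with s hs h1
    refine hs ?_
    rw [Set.mem_singleton_iff] at h1 ⊢
    rw [eq_div_iff hN0]
    linear_combination h1
  have h2 := (riemannZeta_residue_one.comp hmap).const_mul (1 / N : ℂ)
  rw [mul_one] at h2
  refine h2.congr fun s => ?_
  simp only [Function.comp]
  field_simp
  ring

theorem tendsto_sub_mul_residue (hχ : χ.IsPrimitive) (hN : 1 ≤ N) (hNh : (N : ℤ) - 2 * h ≠ -1)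
    (hparity : χ.Even ∨ (χ.Odd ∧ Even N)) {ℓ : ℂ}
    (hℓ : Tendsto (fun s => Complex.Gamma s * LFunction χ s)
      (𝓝[≠] (((N : ℂ) - 2 * h + 1) / N)) (𝓝 ℓ)) (z : ℂ) :
    Tendsto (fun s => (s - z) * (Complex.Gamma s * LFunction χ s *
      riemannZeta (N * s - N + 2 * h))) (𝓝[≠] z)
      (𝓝 (∑ i ∈ Finset.range ((2 * ⌊(h : ℝ) / (N : ℝ)⌋ + 1).toNat + 3),
        if (poleLoc N h i : ℂ) = z then poleRes χ N h ℓ i else 0)) := by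
  have hN0 : (N : ℂ) ≠ 0 := Nat.cast_ne_zero.2 (by omega)
  set J := (2 * ⌊(h : ℝ) / (N : ℝ)⌋ + 1).toNat with hJ
  have hs1 : ((N : ℂ) - 2 * h + 1) / N ≠ 1 := by
    intro h1
    rw [div_eq_one_iff_eq hN0] at h1
    have h2 : (N : ℤ) - 2 * h + 1 = N := by exact_mod_cast h1
    omega
  have hnat : ∀ j : ℕ, (-j : ℂ) ≠ 1 := fun j h => by
    have := congrArg re h
    simp only [neg_re, natCast_re, one_re] at this
    linarith [(Nat.cast_nonneg j : (0 : ℝ) ≤ j)]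
  have hsum : (∑ i ∈ Finset.range (J + 3),
        if (poleLoc N h i : ℂ) = z then poleRes χ N h ℓ i else 0) =
      (∑ j ∈ Finset.range (J + 1), if (-j : ℂ) = z then (-1) ^ j / j.factorial *
        LFunction χ (-j) * riemannZeta (-(N : ℂ) * j - N + 2 * h) else 0) +
      (if ((N : ℂ) - 2 * h + 1) / N = z then ℓ / N else 0) +
      (if 1 = z then (if q = 1 then riemannZeta (2 * h) else 0) else 0) := by
    rw [Finset.sum_range_succ', Finset.sum_range_succ']
    simp [poleLoc, poleRes]
    congr
  rw [hsum]
  have hZ : ∀ z : ℂ, z ≠ ((N : ℂ) - 2 * h + 1) / N →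
      Tendsto (fun s : ℂ => riemannZeta (N * s - N + 2 * h)) (𝓝[≠] z)
        (𝓝 (riemannZeta (N * z - N + 2 * h))) := fun z hz =>
    (differentiableAt_zeta_affine hN hz).continuousAt.tendsto.mono_left nhdsWithin_le_nhds
  by_cases h0 : z = ((N : ℂ) - 2 * h + 1) / N
  · subst h0
    rw [if_neg (Ne.symm hs1), if_pos rfl, add_zero, Finset.sum_eq_zero, zero_add]
    · have := hℓ.mul (tendsto_sub_mul_zeta_affine (h := h) hN)
      rw [mul_one_div] at this
      exact this.congr fun s => by ring
    -- A pole `-j` of `Γ` may sit at the pole of zeta; its entry in the list then vanishes because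
    -- `L(-j, χ) = 0`, and only `ℓ / N` is counted.
    · intro j _
      split_ifs with hj
      · rw [eq_comm, div_eq_iff hN0, neg_mul] at hj
        rw [LFunction_eq_zero_of_zeta_pole hNh hparity (j := j) (by exact_mod_cast hj)]
        ring
      · rfl
  rw [if_neg (Ne.symm h0), add_zero]
  by_cases h1 : z = 1
  · subst h1
    rw [if_pos rfl, Finset.sum_eq_zero fun j _ => if_neg (hnat j), zero_add]
    have := (tendsto_sub_one_mul_Gamma_mul_LFunction hχ).mul (hZ 1 h0)
    rw [ite_mul, one_mul, zero_mul, mul_one, sub_self, zero_add] at this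
    exact this.congr fun s => by ring
  rw [if_neg (Ne.symm h1), add_zero]
  by_cases h2 : ∃ j : ℕ, z = -j
  · obtain ⟨j, rfl⟩ := h2
    have h3 := (tendsto_add_nat_mul_Gamma_mul_LFunction χ j).mul (hZ _ h0)
    have h4 : (N : ℂ) * -j - N + 2 * h = -(N : ℂ) * j - N + 2 * h := by ring
    rw [h4] at h3
    have h5 : (∑ i ∈ Finset.range (J + 1), if (-i : ℂ) = -j then (-1) ^ i / i.factorial *
        LFunction χ (-i) * riemannZeta (-(N : ℂ) * i - N + 2 * h) else 0) =
        (-1) ^ j / j.factorial * LFunction χ (-j) * riemannZeta (-(N : ℂ) * j - N + 2 * h) := by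
      simp only [neg_inj, Nat.cast_inj, Finset.sum_ite_eq', Finset.mem_range]
      split_ifs with hj
      · rfl
      -- Outside the finite range the true residue is zero, matching the empty sum.
      · rw [mul_assoc, LFunction_mul_zeta_eq_zero hN hparity (by omega), mul_zero]
    rw [h5]
    exact h3.congr fun s => by ring
  · push Not at h2
    rw [Finset.sum_eq_zero fun j _ => if_neg (Ne.symm (h2 j))]
    have h3 : Tendsto (fun s => s - z) (𝓝[≠] z) (𝓝 0) :=
      (Continuous.tendsto' (f := fun s : ℂ => s - z) (by fun_prop) _ _
        (sub_self z)).mono_left nhdsWithin_le_nhds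
    have h4 := (differentiableAt_Gamma_mul_LFunction χ h1 h2).continuousAt.tendsto.mono_left
      (nhdsWithin_le_nhds (s := {z}ᶜ))
    have := h3.mul (h4.mul (hZ z h0))
    rwa [zero_mul] at this

theorem exists_entire_completed (hχ : χ.IsPrimitive) (hN : 1 ≤ N) (hNh : (N : ℤ) - 2 * h ≠ -1)
    (hparity : χ.Even ∨ (χ.Odd ∧ Even N)) {ℓ : ℂ}
    (hℓ : Tendsto (fun s => Complex.Gamma s * LFunction χ s)
      (𝓝[≠] (((N : ℂ) - 2 * h + 1) / N)) (𝓝 ℓ)) :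
    ∃ E : ℂ → ℂ, Differentiable ℂ E ∧ ∀ s : ℂ, s.im ≠ 0 →
      E s = Complex.Gamma s * LFunction χ s * riemannZeta (N * s - N + 2 * h) -
        ∑ i ∈ Finset.range ((2 * ⌊(h : ℝ) / (N : ℝ)⌋ + 1).toNat + 3),
          poleRes χ N h ℓ i / (s - poleLoc N h i) := by
  refine exists_entire_sub_residues (fun z => ?_) (fun s hs => ?_)
    (tendsto_sub_mul_residue hχ hN hNh hparity hℓ)
  · have hev : ∀ᶠ s in 𝓝[≠] z, s ≠ ((N : ℂ) - 2 * h + 1) / N := by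
      rcases eq_or_ne z (((N : ℂ) - 2 * h + 1) / N) with h | h
      · filter_upwards [self_mem_nhdsWithin] with s hs
        rwa [← h]
      · exact nhdsWithin_le_nhds (isOpen_ne.mem_nhds h)
    filter_upwards [eventually_differentiableAt_Gamma_mul_LFunction χ z, hev] with s h1 h2
    exact h1.mul (differentiableAt_zeta_affine hN h2)
  · have hreal : ∀ r : ℝ, s ≠ r := fun r hr => hs (by rw [hr, ofReal_im])
    refine (differentiableAt_Gamma_mul_LFunction χ (by simpa using hreal 1) fun j => ?_).mul
      (differentiableAt_zeta_affine hN ?_)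
    · simpa using hreal (-j)
    · simpa using hreal (((N : ℝ) - 2 * h + 1) / N)

end residues

/-! ### Double exponential series attached to products of an `L`-function and zeta -/

theorem summable_nat_add_one_rpow {σ : ℝ} (hσ : 1 < σ) :
    Summable fun n : ℕ => ((n : ℝ) + 1) ^ (-σ) := by
  have := (summable_nat_add_iff 1).2 (Real.summable_nat_rpow.2 (by linarith : -σ < -1))
  simpa using this

open Complex in
theorem hasSum_LFunction {q : ℕ} [NeZero q] (χ : DirichletCharacter ℂ q) {s : ℂ} (hs : 1 < s.re) :
    HasSum (fun n : ℕ => χ ((n + 1 : ℕ) : ZMod q) * (((n : ℝ) + 1 : ℝ) : ℂ) ^ (-s))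
      (DirichletCharacter.LFunction χ s) := by
  have h1 : LSeriesHasSum (χ ·) s (LSeries (χ ·) s) :=
    (ZMod.LSeriesSummable_of_one_lt_re χ hs).LSeriesHasSum
  rw [DirichletCharacter.LFunction_eq_LSeries χ hs]
  have h2 := (hasSum_nat_add_iff' 1).2 h1
  simp only [Finset.range_one, Finset.sum_singleton, LSeries.term_zero, sub_zero] at h2
  refine h2.congr_fun fun n => ?_
  rw [LSeries.term_of_ne_zero n.succ_ne_zero, cpow_neg, div_eq_mul_inv]
  push_cast
  rfl

open Complex in
theorem hasSum_riemannZeta {s : ℂ} (hs : 1 < s.re) :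
    HasSum (fun n : ℕ => (((n : ℝ) + 1 : ℝ) : ℂ) ^ (-s)) (riemannZeta s) := by
  have h := hasSum_LFunction (1 : DirichletCharacter ℂ 1) hs
  rw [DirichletCharacter.LFunction_modOne_eq] at h
  refine h.congr_fun fun n => ?_
  rw [Subsingleton.elim ((n + 1 : ℕ) : ZMod 1) 1, map_one, one_mul]

section doubleSeries

variable {q : ℕ} (χ : DirichletCharacter ℂ q)

/-- The coefficients `χ(m) m ^ e₁ n ^ e₂`, with `m, n ≥ 1`. -/
noncomputable def doubleCoeff (e₁ e₂ : ℝ) (x : ℕ × ℕ) : ℂ :=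
  χ ((x.1 + 1 : ℕ) : ZMod q) * ((((x.1 : ℝ) + 1) ^ e₁ * ((x.2 : ℝ) + 1) ^ e₂ : ℝ) : ℂ)

/-- The exponents `C m ^ d₁ n ^ d₂`, with `m, n ≥ 1`. -/
noncomputable def doubleRate (C d₁ d₂ : ℝ) (x : ℕ × ℕ) : ℝ :=
  C * (((x.1 : ℝ) + 1) ^ d₁ * ((x.2 : ℝ) + 1) ^ d₂)

variable {C : ℝ} (e₁ e₂ d₁ d₂ : ℝ)

theorem doubleRate_pos (hC : 0 < C) (x : ℕ × ℕ) : 0 < doubleRate C d₁ d₂ x := by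
  unfold doubleRate; positivity

variable {e₁ e₂ d₁ d₂}

/-- Since `‖χ‖ ≤ 1`, a product of two zeta series dominates. The parameters serve both sides of the
formula: `(d₁, d₂) = (1, N)` for the Lambert series and `(1/N, 1)` for the dual one. -/
theorem summable_doubleCoeff (hC : 0 < C) {σ : ℝ} (h1 : 1 < d₁ * σ - e₁) (h2 : 1 < d₂ * σ - e₂) :
    Summable fun x => ‖doubleCoeff χ e₁ e₂ x‖ * doubleRate C d₁ d₂ x ^ (-σ) := by
  have hs := ((summable_nat_add_one_rpow h1).mul_of_nonneg (summable_nat_add_one_rpow h2)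
    (fun n => by positivity) (fun n => by positivity)).mul_left (C ^ (-σ))
  refine Summable.of_nonneg_of_le (fun x => ?_) (fun x => ?_) hs
  · have := doubleRate_pos d₁ d₂ hC x
    positivity
  · have hx1 : (0 : ℝ) < (x.1 : ℝ) + 1 := by positivity
    have hx2 : (0 : ℝ) < (x.2 : ℝ) + 1 := by positivity
    have hχ : ‖χ ((x.1 + 1 : ℕ) : ZMod q)‖ ≤ 1 := DirichletCharacter.norm_le_one χ _
    rw [doubleCoeff, doubleRate, norm_mul, Complex.norm_real, Real.norm_of_nonneg (by positivity),
      Real.mul_rpow hC.le (by positivity), Real.mul_rpow (by positivity) (by positivity),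
      ← Real.rpow_mul hx1.le, ← Real.rpow_mul hx2.le]
    have e1 : ((x.1 : ℝ) + 1) ^ (-(d₁ * σ - e₁)) =
        ((x.1 : ℝ) + 1) ^ e₁ * ((x.1 : ℝ) + 1) ^ (d₁ * -σ) := by
      rw [← Real.rpow_add hx1]; ring_nf
    have e2 : ((x.2 : ℝ) + 1) ^ (-(d₂ * σ - e₂)) =
        ((x.2 : ℝ) + 1) ^ e₂ * ((x.2 : ℝ) + 1) ^ (d₂ * -σ) := by
      rw [← Real.rpow_add hx2]; ring_nf
    rw [e1, e2]
    calc _ ≤ 1 * (((x.1 : ℝ) + 1) ^ e₁ * ((x.2 : ℝ) + 1) ^ e₂) *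
          (C ^ (-σ) * (((x.1 : ℝ) + 1) ^ (d₁ * -σ) * ((x.2 : ℝ) + 1) ^ (d₂ * -σ))) := by gcongr
      _ = _ := by ring

open Complex in
/-- The Mellin transform of a double exponential series. -/
theorem mellin_doubleSeries [NeZero q] (hC : 0 < C) {ω : ℂ} (hω : 0 < ω.re) {s : ℂ}
    (hs : 0 < s.re) (h1 : 1 < d₁ * s.re - e₁) (h2 : 1 < d₂ * s.re - e₂) :
    mellin (expSeries (doubleCoeff χ e₁ e₂) (doubleRate C d₁ d₂) ω) s =
      Gamma s * ω ^ (-s) * ((C : ℂ) ^ (-s) * (DirichletCharacter.LFunction χ (d₁ * s - e₁) *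
        riemannZeta (d₂ * s - e₂))) := by
  have h := hasSum_mellin_expSeries (doubleRate_pos d₁ d₂ hC) hω hs
    (summable_doubleCoeff χ hC h1 h2)
  have hL := hasSum_LFunction χ (s := d₁ * s - e₁) (by simpa using h1)
  have hZ := hasSum_riemannZeta (s := d₂ * s - e₂) (by simpa using h2)
  have hprod := hL.mul hZ (summable_mul_of_summable_norm
    (f := fun n : ℕ => χ ((n + 1 : ℕ) : ZMod q) * (((n : ℝ) + 1 : ℝ) : ℂ) ^ (-(d₁ * s - e₁)))
    (g := fun n : ℕ => (((n : ℝ) + 1 : ℝ) : ℂ) ^ (-(d₂ * s - e₂)))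
    hL.summable.norm hZ.summable.norm)
  have hc : ∀ (t : ℝ), 0 < t → ∀ d e : ℝ, (t : ℂ) ^ (-((d : ℂ) * s - e)) =
      ((t ^ e : ℝ) : ℂ) * ((t ^ d : ℝ) : ℂ) ^ (-s) := fun t ht d e => by
    have ht0 : (t : ℂ) ≠ 0 := ofReal_ne_zero.2 ht.ne'
    have ht1 : ((t ^ d : ℝ) : ℂ) ≠ 0 := ofReal_ne_zero.2 (Real.rpow_pos_of_pos ht d).ne'
    rw [ofReal_cpow ht.le, cpow_def_of_ne_zero ht1, ← ofReal_log (Real.rpow_pos_of_pos ht d).le,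
      Real.log_rpow ht, cpow_def_of_ne_zero ht0, cpow_def_of_ne_zero ht0, ← exp_add,
      ofReal_mul, ofReal_log ht.le]
    ring_nf
  have hterm : ∀ x : ℕ × ℕ, Gamma s * ω ^ (-s) *
      (doubleCoeff χ e₁ e₂ x * (doubleRate C d₁ d₂ x : ℂ) ^ (-s)) =
      Gamma s * ω ^ (-s) * ((C : ℂ) ^ (-s) *
        (χ ((x.1 + 1 : ℕ) : ZMod q) * (((x.1 : ℝ) + 1 : ℝ) : ℂ) ^ (-((d₁ : ℂ) * s - e₁)) *
        (((x.2 : ℝ) + 1 : ℝ) : ℂ) ^ (-((d₂ : ℂ) * s - e₂)))) := fun x => by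
    have hx1 : (0 : ℝ) < (x.1 : ℝ) + 1 := by positivity
    have hx2 : (0 : ℝ) < (x.2 : ℝ) + 1 := by positivity
    have hA := (Real.rpow_pos_of_pos hx1 d₁).le
    have hB := (Real.rpow_pos_of_pos hx2 d₂).le
    have hP : (doubleRate C d₁ d₂ x : ℂ) ^ (-s) = (C : ℂ) ^ (-s) *
        (((((x.1 : ℝ) + 1) ^ d₁ : ℝ) : ℂ) ^ (-s) * ((((x.2 : ℝ) + 1) ^ d₂ : ℝ) : ℂ) ^ (-s)) := by
      rw [← mul_cpow_ofReal_nonneg hA hB, ← ofReal_mul,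
        ← mul_cpow_ofReal_nonneg hC.le (mul_nonneg hA hB), ← ofReal_mul, doubleRate]
    rw [hc _ hx1, hc _ hx2, hP, doubleCoeff, ofReal_mul]
    ring
  have h' := (hprod.mul_left ((C : ℂ) ^ (-s))).mul_left (Gamma s * ω ^ (-s))
  rw [← h.tsum_eq, ← h'.tsum_eq]
  exact tsum_congr hterm

end doubleSeries

/-! ### The Lambert series as a double exponential series -/

theorem sum_Icc_one_eq_sum_fin (q : ℕ) (f : ℕ → ℂ) :
    ∑ r ∈ Finset.Icc 1 q, f r = ∑ r : Fin q, f (r + 1) := by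
  rw [Fin.sum_univ_eq_sum_range (fun r => f (r + 1)), Finset.range_eq_Ico,
    Finset.sum_Ico_add' f 0 q 1, ← Finset.Ico_succ_right_eq_Icc]
  simp

/-- Splitting the first index into residue and quotient modulo `q`. -/
def residueEquiv (q : ℕ) [NeZero q] : Fin q × (ℕ × ℕ) ≃ ℕ × ℕ where
  toFun x := ((Nat.divModEquiv q).symm (x.2.2, x.1), x.2.1)
  invFun y := ((Nat.divModEquiv q y.1).2, (y.2, (Nat.divModEquiv q y.1).1))
  left_inv x := by simp only [Equiv.apply_symm_apply]
  right_inv y := by simp only [Prod.mk.eta, Equiv.symm_apply_apply]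

/-- The double exponential series equals the sum over residues of a series of series. -/
theorem tsum_residues {q : ℕ} [NeZero q] {T : ℕ × ℕ → ℂ} (hT : Summable T) {S : ℕ → ℕ → ℂ}
    (hS : ∀ r n : ℕ, r < q → HasSum (fun k => T (r + q * k, n)) (S r n)) :
    (∀ r < q, Summable (S r)) ∧ ∑' x, T x = ∑ r : Fin q, ∑' n, S r n := by
  have h1 : Summable (T ∘ residueEquiv q) := (residueEquiv q).summable_iff.2 hT
  have hval : ∀ (r : Fin q) (n k : ℕ), (T ∘ residueEquiv q) (r, (n, k)) = T (r + q * k, n) := by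
    intro r n k
    simp only [Function.comp, residueEquiv, Equiv.coe_fn_mk, Nat.divModEquiv_symm_apply]
    congr 2
    ring
  have h2 : ∀ r : Fin q, Summable fun y : ℕ × ℕ => (T ∘ residueEquiv q) (r, y) := fun r =>
    h1.comp_injective (i := fun y : ℕ × ℕ => (r, y)) fun a b h => (Prod.mk.inj h).2
  have h3 : ∀ r : Fin q, HasSum (S r) (∑' y : ℕ × ℕ, (T ∘ residueEquiv q) (r, y)) := fun r =>
    (h2 r).hasSum.prod_fiberwise fun n => by
      simp only [hval]
      exact hS r n r.2
  refine ⟨fun r hr => (h3 ⟨r, hr⟩).summable, ?_⟩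
  rw [← (residueEquiv q).tsum_eq]
  have := h1.tsum_prod' h2
  simp only [Function.comp] at this
  rw [this, tsum_fintype]
  exact Finset.sum_congr rfl fun r _ => ((h3 r).tsum_eq).symm

section lambert

open Complex

variable {q : ℕ} [NeZero q] (χ : DirichletCharacter ℂ q) {N : ℕ}

/-- A bound to the right of which the Dirichlet series of the double series converge. -/
noncomputable def convBound (h : ℤ) : ℝ := 3 + |2 * (h : ℝ)|

theorem convBound_spec (hN : 1 ≤ N) (h : ℤ) {σ : ℝ} (hσ : convBound h ≤ σ) :
    0 < σ ∧ 1 < 1 * σ - 0 ∧ 1 < (N : ℝ) * σ - ((N : ℝ) - 2 * h) := by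
  have hN' : (1 : ℝ) ≤ N := by exact_mod_cast hN
  unfold convBound at hσ
  have h1 := abs_nonneg (2 * (h : ℝ))
  have h2 := neg_abs_le (2 * (h : ℝ))
  refine ⟨by linarith, by linarith, ?_⟩
  nlinarith

/-- A geometric series in `k`: the index `m = (r + 1) + q k` runs through one residue class, on
which `χ` is constant, and `m / q` increases by `1` at each step. -/
theorem hasSum_lambertTerm (h : ℤ) {x : ℝ} (hx : 0 < x) (r n : ℕ) :
    HasSum (fun k : ℕ => doubleCoeff χ 0 ((N : ℝ) - 2 * h) (r + q * k, n) *
      cexp (-(doubleRate 1 1 N (r + q * k, n) * 1 * (x / q : ℝ))))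
      (lambertTerm N h x χ (r + 1) (n + 1)) := by
  have hq : (q : ℂ) ≠ 0 := Nat.cast_ne_zero.2 (NeZero.ne q)
  set Y : ℝ := ((n : ℝ) + 1) ^ N * x with hY
  have hY0 : 0 < Y := by positivity
  have hnorm : ‖cexp (-(Y : ℂ))‖ < 1 := by
    rw [norm_exp, neg_re, ofReal_re, Real.exp_lt_one_iff]
    linarith
  have hg := (hasSum_geometric_of_norm_lt_one hnorm).mul_left
    (χ ((r + 1 : ℕ) : ZMod q) * ((n + 1 : ℕ) : ℂ) ^ ((N : ℤ) - 2 * h) *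
      cexp (-(((r + 1 : ℕ) : ℂ) / q) * ((n + 1 : ℕ) : ℂ) ^ N * x))
  have hYc : (Y : ℂ) = ((n + 1 : ℕ) : ℂ) ^ N * x := by rw [hY]; push_cast; ring
  have hl : lambertTerm N h x χ (r + 1) (n + 1) = χ ((r + 1 : ℕ) : ZMod q) *
      ((n + 1 : ℕ) : ℂ) ^ ((N : ℤ) - 2 * h) *
      cexp (-(((r + 1 : ℕ) : ℂ) / q) * ((n + 1 : ℕ) : ℂ) ^ N * x) * (1 - cexp (-(Y : ℂ)))⁻¹ := by
    rw [lambertTerm, div_eq_mul_inv, ← hYc]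
  rw [hl]
  refine hg.congr_fun fun k => ?_
  have hχ : χ ((r + q * k + 1 : ℕ) : ZMod q) = χ ((r + 1 : ℕ) : ZMod q) := by
    congr 1
    push_cast
    rw [ZMod.natCast_self]
    ring
  have hpow : (((n : ℝ) + 1) ^ ((N : ℝ) - 2 * h) : ℝ) = ((n : ℝ) + 1) ^ ((N : ℤ) - 2 * h) := by
    rw [← Real.rpow_intCast]
    push_cast
    rfl
  have hexp : cexp (-(doubleRate 1 1 N (r + q * k, n) * 1 * (x / q : ℝ))) =
      cexp (-(((r + 1 : ℕ) : ℂ) / q) * ((n + 1 : ℕ) : ℂ) ^ N * x) * cexp (-(Y : ℂ)) ^ k := by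
    rw [← exp_nat_mul, ← exp_add, hYc, doubleRate, Real.rpow_one, Real.rpow_natCast]
    congr 1
    push_cast
    field_simp
    ring
  rw [doubleCoeff, Real.rpow_zero, one_mul, hpow, hexp, hχ]
  push_cast
  ring

theorem lambert_eq (hN : 1 ≤ N) (h : ℤ) {x : ℝ} (hx : 0 < x) :
    (∀ r ∈ Finset.Icc 1 q, Summable fun n : ℕ => lambertTerm N h x χ r (n + 1)) ∧
    lambertF N h x χ =
      expSeries (doubleCoeff χ 0 ((N : ℝ) - 2 * h)) (doubleRate 1 1 N) 1 (x / q) := by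
  have hc := convBound_spec hN h le_rfl
  have hq : (0 : ℝ) < q := Nat.cast_pos.2 (NeZero.pos q)
  have hsum := summable_expSeries (doubleRate_pos 1 N one_pos) (ω := 1) (by simp) hc.1
    (summable_doubleCoeff χ one_pos hc.2.1 hc.2.2) (div_pos hx hq)
  have key := tsum_residues (q := q) hsum (S := fun r n => lambertTerm N h x χ (r + 1) (n + 1))
    fun r n _ => hasSum_lambertTerm χ h hx r n
  constructor
  · intro r hr
    rw [Finset.mem_Icc] at hr
    have := key.1 (r - 1) (by omega)
    rwa [Nat.sub_add_cancel hr.1] at this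
  · rw [expSeries, key.2, lambertF, sum_Icc_one_eq_sum_fin]

end lambert

/-! ### The dual series as double exponential series -/

section dual

open Complex

variable {q : ℕ} (χ : DirichletCharacter ℂ q) {N : ℕ}

/-- The direction `exp (-iπj/(2N))`. -/
noncomputable def dualDir (N : ℕ) (j : ℤ) : ℂ := cexp (-(I * (Real.pi : ℂ) * j / (2 * N)))

/-- The angle `πj / (2N)` is less than `π / 2` in absolute value; this is what makes every `G_j`
converge. -/
theorem dualDir_re_pos (hN : 1 ≤ N) {j : ℤ} (hj : |j| < N) : 0 < (dualDir N j).re := by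
  have hN' : (0 : ℝ) < N := by exact_mod_cast hN
  have h1 : dualDir N j = cexp (((-(Real.pi * j / (2 * N)) : ℝ) : ℂ) * I) := by
    rw [dualDir]; congr 1; push_cast; ring
  rw [h1, exp_ofReal_mul_I_re]
  have h2 : |(j : ℝ)| < N := by exact_mod_cast hj
  refine Real.cos_pos_of_mem_Ioo ?_
  have h3 : |-(Real.pi * j / (2 * N))| < Real.pi / 2 := by
    rw [abs_neg, abs_div, abs_mul, abs_of_pos Real.pi_pos, abs_of_pos (by positivity : (0 : ℝ) < 2 * N),
      div_lt_div_iff₀ (by positivity) two_pos]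
    nlinarith [Real.pi_pos]
  exact ⟨by linarith [(abs_lt.1 h3).1], (abs_lt.1 h3).2⟩

/-- The constant `2π (2π) ^ (1/N)` in the exponents of the dual series. -/
noncomputable def dualConst (N : ℕ) : ℝ := 2 * Real.pi * (2 * Real.pi) ^ (1 / (N : ℝ))

theorem dualConst_pos (N : ℕ) : 0 < dualConst N := by unfold dualConst; positivity

/-- The expansion `1 / (e^z - 1) = ∑ e^{-(k+1) z}` for `re z > 0`, with the dependence of `z` on `x`
isolated as the factor `x ^ (-1/N)`. -/
theorem hasSum_dualTerm (hN : 1 ≤ N) {x : ℝ} (hx : 0 < x) {j : ℤ} (hj : |j| < N) (a : ℝ) (n : ℕ) :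
    HasSum (fun k : ℕ => doubleCoeff χ (-a) 0 (n, k) *
      cexp (-(doubleRate (dualConst N) (1 / N) 1 (n, k) * dualDir N j * (x ^ (-(1 / N : ℝ)) : ℝ))))
      (dualTerm N j a (2 * Real.pi / x) χ (n + 1)) := by
  have hre := dualDir_re_pos hN hj
  set Y : ℝ := (((n + 1 : ℕ) : ℝ) * (2 * Real.pi / x)) ^ (1 / (N : ℝ)) with hY
  have hY0 : 0 < Y := by positivity
  set z : ℂ := 2 * (Real.pi : ℂ) * Y * dualDir N j with hz
  have hzre : 0 < z.re := by
    have : z = ((2 * Real.pi * Y : ℝ) : ℂ) * dualDir N j := by rw [hz]; push_cast; ring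
    rw [this, re_ofReal_mul]
    positivity
  have hnorm : ‖cexp (-z)‖ < 1 := by
    rw [norm_exp, neg_re, Real.exp_lt_one_iff]
    linarith
  have hg := (hasSum_geometric_of_norm_lt_one hnorm).mul_left
    (χ ((n + 1 : ℕ) : ZMod q) * ((((n : ℝ) + 1) ^ (-a) : ℝ) : ℂ) * cexp (-z))
  have hval : χ ((n + 1 : ℕ) : ZMod q) * ((((n : ℝ) + 1) ^ (-a) : ℝ) : ℂ) * cexp (-z) *
      (1 - cexp (-z))⁻¹ = dualTerm N j a (2 * Real.pi / x) χ (n + 1) := by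
    have h1 : cexp (-z) * (1 - cexp (-z))⁻¹ = (cexp z - 1)⁻¹ := by
      have hne : 1 - cexp (-z) ≠ 0 := by
        intro h0
        rw [sub_eq_zero] at h0
        rw [← h0, norm_one] at hnorm
        exact lt_irrefl _ hnorm
      have he : cexp z - 1 = (1 - cexp (-z)) * cexp z := by
        rw [sub_mul, ← exp_add]; simp
      rw [he, mul_inv, exp_neg]
      ring
    rw [mul_assoc, h1, dualTerm, ← dualDir, ← hY, ← hz]
    rw [Real.rpow_neg (by positivity), one_div]
    push_cast
    ring
  rw [← hval]
  refine hg.congr_fun fun k => ?_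
  have hrate : (doubleRate (dualConst N) (1 / N) 1 (n, k) : ℂ) * dualDir N j *
      (x ^ (-(1 / N : ℝ)) : ℝ) = (k + 1) * z := by
    have h1 : Y = ((n : ℝ) + 1) ^ (1 / (N : ℝ)) * (2 * Real.pi) ^ (1 / (N : ℝ)) *
        x ^ (-(1 / N : ℝ)) := by
      rw [hY, Nat.cast_add, Nat.cast_one, Real.mul_rpow (by positivity) (by positivity),
        Real.div_rpow (by positivity) hx.le, Real.rpow_neg hx.le]
      ring
    rw [hz, h1, doubleRate, dualConst, Real.rpow_one]
    push_cast
    ring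
  rw [hrate, doubleCoeff, Real.rpow_zero, mul_one, ← exp_nat_mul, mul_assoc, mul_assoc, mul_assoc,
    ← exp_add]
  congr 3
  ring

theorem dual_spec (hN : 1 ≤ N) {a σ : ℝ} (hσ : N * (2 + |a|) ≤ σ) :
    0 < σ ∧ 1 < 1 / N * σ - (-a) ∧ 1 < 1 * σ - 0 := by
  have hN' : (1 : ℝ) ≤ N := by exact_mod_cast hN
  have h1 := abs_nonneg a
  have h2 := neg_abs_le a
  have h3 : 2 + |a| ≤ 1 / N * σ := by
    rw [one_div_mul_eq_div, le_div_iff₀ (by linarith)]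
    linarith
  have h4 : 2 + |a| ≤ σ := by nlinarith
  exact ⟨by linarith, by linarith, by linarith⟩

theorem dual_eq (hN : 1 ≤ N) {x : ℝ} (hx : 0 < x) {j : ℤ} (hj : |j| < N) (a : ℝ) :
    (Summable fun n : ℕ => dualTerm N j a (2 * Real.pi / x) χ (n + 1)) ∧
    dualG N j a (2 * Real.pi / x) χ = expSeries (doubleCoeff χ (-a) 0)
      (doubleRate (dualConst N) (1 / N) 1) (dualDir N j) (x ^ (-(1 / N : ℝ))) := by
  have hc := dual_spec hN (a := a) le_rfl
  have hsum := summable_expSeries (doubleRate_pos (1 / N) 1 (dualConst_pos N))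
    (dualDir_re_pos hN hj) hc.1 (summable_doubleCoeff χ (dualConst_pos N) hc.2.1 hc.2.2)
    (Real.rpow_pos_of_pos hx (-(1 / N : ℝ)))
  have := hsum.hasSum.prod_fiberwise fun n => hasSum_dualTerm χ hN hx hj a n
  exact ⟨this.summable, this.tsum_eq⟩

end dual

/-! ### Dirichlet kernel identities producing the weights `v_{N,χ}(j)` -/

open Complex in
theorem sin_mul_sum_exp (N : ℕ) (u : ℂ) :
    sin (Real.pi * u) * ∑ k ∈ Finset.range N,
      cexp (I * Real.pi * ((2 * (k : ℤ) - ((N : ℤ) - 1) : ℤ) : ℂ) * u) = sin (Real.pi * N * u) := by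
  -- Multiplication by `2i sin(πu)` makes the sum telescope.
  have h1 : ∀ k : ℕ, 2 * I * sin (Real.pi * u) *
      cexp (I * Real.pi * ((2 * (k : ℤ) - ((N : ℤ) - 1) : ℤ) : ℂ) * u) =
      cexp (I * Real.pi * (2 * ((k + 1 : ℕ) : ℂ) - N) * u) -
        cexp (I * Real.pi * (2 * (k : ℂ) - N) * u) := fun k => by
    have h2 : 2 * I * sin (Real.pi * u) = cexp (I * Real.pi * u) - cexp (-(I * Real.pi * u)) := by
      rw [sin]
      have : 2 * I * ((cexp (-(Real.pi * u) * I) - cexp (Real.pi * u * I)) * I / 2) =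
        (I * I) * (cexp (-(Real.pi * u) * I) - cexp (Real.pi * u * I)) := by ring
      rw [this, I_mul_I]
      ring_nf
    rw [h2, sub_mul, ← exp_add, ← exp_add]
    push_cast
    ring_nf
  have h3 : 2 * I * (sin (Real.pi * u) * ∑ k ∈ Finset.range N,
      cexp (I * Real.pi * ((2 * (k : ℤ) - ((N : ℤ) - 1) : ℤ) : ℂ) * u)) =
      2 * I * sin (Real.pi * N * u) := by
    rw [← mul_assoc, Finset.mul_sum, Finset.sum_congr rfl fun k _ => h1 k,
      Finset.sum_range_sub (fun k : ℕ => cexp (I * Real.pi * (2 * (k : ℂ) - N) * u)), sin]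
    have : 2 * I * ((cexp (-(Real.pi * N * u) * I) - cexp (Real.pi * N * u * I)) * I / 2) =
      (I * I) * (cexp (-(Real.pi * N * u) * I) - cexp (Real.pi * N * u * I)) := by ring
    rw [this, I_mul_I]
    push_cast
    ring_nf
  exact mul_left_cancel₀ (mul_ne_zero two_ne_zero I_ne_zero) h3

open Complex in
theorem sin_eq_mul_sum_vCoeff_even {q : ℕ} {χ : DirichletCharacter ℂ q} (he : χ.Even)
    (N : ℕ) (s : ℂ) :
    sin (Real.pi * N * (1 - s) / 2) = cos (Real.pi * s / 2) * ∑ k ∈ Finset.range N,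
      vCoeff N χ (2 * (k : ℤ) - ((N : ℤ) - 1)) *
        cexp (I * Real.pi * ((2 * (k : ℤ) - ((N : ℤ) - 1) : ℤ) : ℂ) * ((1 - s) / 2)) := by
  simp only [vCoeff, if_pos he, one_mul]
  rw [mul_div_assoc, ← sin_mul_sum_exp, ← sin_pi_div_two_sub]
  congr 2
  ring

open Complex in
theorem sin_eq_mul_sum_vCoeff_odd {q : ℕ} {χ : DirichletCharacter ℂ q} (ho : χ.Odd)
    {N : ℕ} (hN : Even N) (s : ℂ) :
    -I * sin (Real.pi * N * (1 - s) / 2) = sin (Real.pi * s / 2) * ∑ k ∈ Finset.range N,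
      vCoeff N χ (2 * (k : ℤ) - ((N : ℤ) - 1)) *
        cexp (I * Real.pi * ((2 * (k : ℤ) - ((N : ℤ) - 1) : ℤ) : ℂ) * ((1 - s) / 2)) := by
  have hne : ¬ χ.Even := ho.not_even
  obtain ⟨m, rfl⟩ := hN
  -- As `i^j = exp(iπj/2)`, the odd weight shifts `u = (1 - s)/2` by `1/2`. This turns `sin(πu)`
  -- into `sin(πs/2)` and, as `N = 2m`, changes `sin(πNu)` only by the sign `(-1)^m`.
  have hv : ∀ j : ℤ, vCoeff (m + m) χ j * cexp (I * Real.pi * (j : ℂ) * ((1 - s) / 2)) =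
      (-1) ^ m * (-I) * cexp (I * Real.pi * (j : ℂ) * ((2 - s) / 2)) := fun j => by
    have hI : I ^ j = cexp (I * Real.pi * (j : ℂ) / 2) := by
      rw [show I * Real.pi * (j : ℂ) / 2 = j * (Real.pi / 2 * I) by ring, exp_int_mul,
        exp_pi_div_two_mul_I]
    rw [vCoeff, if_neg hne, show (m + m) / 2 = m by omega, zpow_sub₀ I_ne_zero, zpow_one, hI,
      div_I, show I * Real.pi * (j : ℂ) * ((2 - s) / 2) =
        I * Real.pi * (j : ℂ) / 2 + I * Real.pi * (j : ℂ) * ((1 - s) / 2) by ring, exp_add]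
    ring
  have hsin : sin (Real.pi * s / 2) = sin (Real.pi * ((2 - s) / 2)) := by
    rw [← sin_pi_sub]
    ring_nf
  have hsq : ((-1 : ℂ) ^ m) * (-1) ^ m = 1 := by rw [← mul_pow]; simp
  rw [Finset.sum_congr rfl fun k _ => hv _, ← Finset.mul_sum, mul_left_comm, hsin, sin_mul_sum_exp,
    show (Real.pi * ((m + m : ℕ) : ℂ) * ((2 - s) / 2) : ℂ) =
      Real.pi * ((m + m : ℕ) : ℂ) * (1 - s) / 2 + m * Real.pi by push_cast; ring,
    sin_antiperiodic.add_nat_mul_eq m]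
  linear_combination (I * sin (Real.pi * ((m + m : ℕ) : ℂ) * (1 - s) / 2)) * hsq

/-! ### The functional equation of the completed product -/

section functionalEquation

open Complex DirichletCharacter

open scoped ZMod

variable {q : ℕ} [NeZero q] {χ : DirichletCharacter ℂ q}

theorem ZMod.LFunction_const_mul (c : ℂ) (Φ : ZMod q → ℂ) (s : ℂ) :
    ZMod.LFunction (fun j => c * Φ j) s = c * ZMod.LFunction Φ s := by
  simp only [ZMod.LFunction, mul_assoc, ← Finset.mul_sum]
  ring

theorem ne_intCast_of_im_ne_zero {s : ℂ} (hs : s.im ≠ 0) (n : ℤ) : s ≠ n := by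
  rintro rfl
  simp at hs

theorem sin_half_ne_zero {s : ℂ} (hs : s.im ≠ 0) : sin (Real.pi * s / 2) ≠ 0 := by
  rw [sin_ne_zero_iff]
  intro k hk
  have := congrArg Complex.im hk
  simp [Real.pi_ne_zero, hs] at this

theorem cos_half_ne_zero {s : ℂ} (hs : s.im ≠ 0) : cos (Real.pi * s / 2) ≠ 0 := by
  rw [cos_ne_zero_iff]
  intro k hk
  have := congrArg Complex.im hk
  simp [Real.pi_ne_zero, hs] at this

/-- The functional equation in asymmetric form: `ε` is `1` for even and `-1` for odd `χ`. -/
theorem LFunction_functional_equation (hχ : χ.IsPrimitive) {s : ℂ} (hs : s.im ≠ 0) {ε : ℂ}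
    (hε : χ (-1) = ε) :
    LFunction χ s = (q : ℂ) ^ (-s) * (2 * Real.pi) ^ (s - 1) * Complex.Gamma (1 - s) *
      (cexp (Real.pi * I * (1 - s) / 2) * ε + cexp (-Real.pi * I * (1 - s) / 2)) *
      (gaussSum χ ZMod.stdAddChar * LFunction (star χ) (1 - s)) := by
  have him : (1 - s).im ≠ 0 := by simpa using hs
  have hsq : ε * ε = 1 := by rw [← hε, ← map_mul]; simp
  -- Primitivity enters here: the discrete Fourier transform of `χ` is a multiple of the conjugate
  -- character.
  have hF : ∀ k, 𝓕 (χ : ZMod q → ℂ) k = ε * gaussSum χ ZMod.stdAddChar * (star χ) k := fun k => by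
    rw [hχ.fourierTransform_eq_inv_mul_gaussSum, MulChar.star_eq_inv, ← neg_one_mul k, map_mul,
      MulChar.inv_apply_eq_inv' χ (-1), hε, inv_eq_of_mul_eq_one_left hsq]
    ring
  have hneg : (fun x => χ (-x)) = ε • (χ : ZMod q → ℂ) := by
    ext x
    rw [← neg_one_mul, map_mul, hε, Pi.smul_apply, smul_eq_mul]
  have hF2 : 𝓕 (fun x => χ (-x)) = fun k => gaussSum χ ZMod.stdAddChar * (star χ) k := by
    ext k
    rw [hneg, _root_.map_smul, Pi.smul_apply, hF, smul_eq_mul]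
    linear_combination gaussSum χ ZMod.stdAddChar * (star χ) k * hsq
  have h := ZMod.LFunction_one_sub (χ : ZMod q → ℂ) (s := 1 - s)
    (fun n => by simpa using ne_intCast_of_im_ne_zero him (-n))
    (Or.inr (by simpa using ne_intCast_of_im_ne_zero him 1))
  rw [funext hF, hF2, ZMod.LFunction_const_mul, ZMod.LFunction_const_mul, sub_sub_cancel,
    show (1 - s - 1 : ℂ) = -s by ring, show (-(1 - s) : ℂ) = s - 1 by ring] at h
  rw [LFunction, h, LFunction]
  ring

/-- The two exponentials combine to `2 sin(πs/2)`. Reflection gives `Γ(s) Γ(1-s) = π / (2 sin(πs/2)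
cos(πs/2))`, so only the cosine remains; for odd `χ` the roles of sine and cosine are exchanged. -/
theorem Gamma_mul_LFunction_even (hχ : χ.IsPrimitive) (he : χ.Even) {s : ℂ} (hs : s.im ≠ 0) :
    Complex.Gamma s * LFunction χ s * cos (Real.pi * s / 2) =
      (q : ℂ) ^ (-s) * (2 * Real.pi) ^ (s - 1) * Real.pi *
        (gaussSum χ ZMod.stdAddChar * LFunction (star χ) (1 - s)) := by
  have hsin := sin_half_ne_zero hs
  have hcos := cos_half_ne_zero hs
  have hΓ := Complex.Gamma_mul_Gamma_one_sub s
  rw [show (Real.pi * s : ℂ) = 2 * (Real.pi * s / 2) by ring, sin_two_mul,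
    eq_div_iff (by simp [hsin, hcos])] at hΓ
  have hexp : cexp (Real.pi * I * (1 - s) / 2) * 1 + cexp (-Real.pi * I * (1 - s) / 2) =
      2 * sin (Real.pi * s / 2) := by
    rw [← cos_pi_div_two_sub, two_cos, mul_one]
    ring_nf
  rw [LFunction_functional_equation hχ hs he, hexp]
  linear_combination ((q : ℂ) ^ (-s) * (2 * Real.pi) ^ (s - 1) *
        (gaussSum χ ZMod.stdAddChar * LFunction (star χ) (1 - s))) * hΓ

theorem Gamma_mul_LFunction_odd (hχ : χ.IsPrimitive) (ho : χ.Odd) {s : ℂ} (hs : s.im ≠ 0) :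
    Complex.Gamma s * LFunction χ s * sin (Real.pi * s / 2) =
      (q : ℂ) ^ (-s) * (2 * Real.pi) ^ (s - 1) * (Real.pi * (-I)) *
        (gaussSum χ ZMod.stdAddChar * LFunction (star χ) (1 - s)) := by
  have hsin := sin_half_ne_zero hs
  have hcos := cos_half_ne_zero hs
  have hΓ := Complex.Gamma_mul_Gamma_one_sub s
  rw [show (Real.pi * s : ℂ) = 2 * (Real.pi * s / 2) by ring, sin_two_mul,
    eq_div_iff (by simp [hsin, hcos])] at hΓ
  have hexp : cexp (Real.pi * I * (1 - s) / 2) * (-1) + cexp (-Real.pi * I * (1 - s) / 2) =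
      2 * cos (Real.pi * s / 2) * (-I) := by
    rw [← sin_pi_div_two_sub, two_sin, mul_assoc _ I (-I), mul_neg I I, I_mul_I, neg_neg, mul_one]
    ring_nf
  rw [LFunction_functional_equation hχ hs ho, hexp]
  linear_combination ((q : ℂ) ^ (-s) * (2 * Real.pi) ^ (s - 1) * (-I) *
        (gaussSum χ ZMod.stdAddChar * LFunction (star χ) (1 - s))) * hΓ

/-- The functional equation of `Γ(s) L(s, χ) ζ(Ns - N + 2h)`. -/
theorem completed_functional_equation (hχ : χ.IsPrimitive) {N : ℕ} (hN : 1 ≤ N) (h : ℤ)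
    (hparity : χ.Even ∨ (χ.Odd ∧ Even N)) {s w : ℂ} (hs : s.im ≠ 0)
    (hw : w = N - 2 * h + 1 - N * s) :
    Complex.Gamma s * LFunction χ s * riemannZeta (N * s - N + 2 * h) =
      (-1) ^ (h + 1) * gaussSum χ ZMod.stdAddChar * (q : ℂ) ^ (-s) * (2 * Real.pi) ^ (s - w) *
        (Complex.Gamma w * (LFunction (star χ) (1 - s) * riemannZeta w)) *
        ∑ k ∈ Finset.range N, vCoeff N χ (2 * (k : ℤ) - ((N : ℤ) - 1)) *
          cexp (I * Real.pi * ((2 * (k : ℤ) - ((N : ℤ) - 1) : ℤ) : ℂ) * ((1 - s) / 2)) := by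
  have hN0 : (N : ℝ) ≠ 0 := by positivity
  have hwim : w.im ≠ 0 := by
    rw [hw]
    simp [hN0, hs]
  have hz := riemannZeta_one_sub (s := w)
    (fun n => by simpa using ne_intCast_of_im_ne_zero hwim (-n))
    (by simpa using ne_intCast_of_im_ne_zero hwim 1)
  -- The cosine in the functional equation of zeta supplies both the sign `(-1)^(h+1)` and the
  -- numerator of the Dirichlet kernel.
  have hcos : cos (Real.pi * w / 2) = (-1) ^ (h + 1) * sin (Real.pi * N * (1 - s) / 2) := by
    rw [show (Real.pi * w / 2 : ℂ) =
      Real.pi * N * (1 - s) / 2 + Real.pi / 2 - h * Real.pi by rw [hw]; ring,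
      cos_antiperiodic.sub_int_mul_eq h, Int.cast_negOnePow, cos_add_pi_div_two, zpow_add₀ (by norm_num), zpow_one]
    ring
  have hpi : (2 * Real.pi : ℂ) ≠ 0 := by simp [Real.pi_ne_zero]
  have hpow : (2 * Real.pi : ℂ) ^ (s - w) =
      (2 * Real.pi) ^ (s - 1) * Real.pi * (2 * (2 * Real.pi) ^ (-w)) := by
    rw [show s - w = (s - 1) + 1 + -w by ring, cpow_add _ _ hpi, cpow_add _ _ hpi, cpow_one]
    ring
  rw [show (N * s - N + 2 * h : ℂ) = 1 - w by rw [hw]; ring, hz, hcos, hpow]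
  rcases hparity with he | ⟨ho, hNe⟩
  · have h1 := Gamma_mul_LFunction_even hχ he hs
    have h2 := sin_eq_mul_sum_vCoeff_even he N s
    refine mul_left_cancel₀ (cos_half_ne_zero hs) ?_
    rw [mul_left_comm (cos (Real.pi * s / 2)) _ (∑ k ∈ Finset.range N, _), ← h2]
    linear_combination (2 * (2 * Real.pi : ℂ) ^ (-w) * Complex.Gamma w *
      ((-1) ^ (h + 1) * sin (Real.pi * N * (1 - s) / 2)) * riemannZeta w) * h1
  · have h1 := Gamma_mul_LFunction_odd hχ ho hs
    have h2 := sin_eq_mul_sum_vCoeff_odd ho hNe s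
    refine mul_left_cancel₀ (sin_half_ne_zero hs) ?_
    rw [mul_left_comm (sin (Real.pi * s / 2)) _ (∑ k ∈ Finset.range N, _), ← h2]
    linear_combination (2 * (2 * Real.pi : ℂ) ^ (-w) * Complex.Gamma w *
      ((-1) ^ (h + 1) * sin (Real.pi * N * (1 - s) / 2)) * riemannZeta w) * h1

end functionalEquation

/-! ### Mellin transform and bounds of `𝓙_χ` -/

open Complex Set MeasureTheory Filter in
theorem mellinConvergent_of_rpow_bounds {f : ℝ → ℂ} (hf : ContinuousOn f (Ioi 0)) {σ₀ : ℝ}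
    (hb : ∀ σ, σ₀ ≤ σ → ∃ C, ∀ t, 0 < t → ‖f t‖ ≤ C * t ^ (-σ)) {s : ℂ} (hs : σ₀ < s.re) :
    MellinConvergent f s := by
  obtain ⟨C₁, h₁⟩ := hb σ₀ le_rfl
  obtain ⟨C₂, h₂⟩ := hb (s.re + 1) (by linarith)
  have key : ∀ {C σ t : ℝ}, 0 < t → ‖f t‖ ≤ C * t ^ (-σ) → ‖f t‖ ≤ C * ‖t ^ (-σ)‖ :=
    fun ht h => by rwa [Real.norm_of_nonneg (Real.rpow_nonneg ht.le _)]
  refine mellinConvergent_of_isBigO_rpow (a := s.re + 1) (b := σ₀)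
    (hf.locallyIntegrableOn measurableSet_Ioi) ?_ (by linarith) ?_ hs
  · refine Asymptotics.IsBigO.of_bound C₂ ?_
    filter_upwards [eventually_gt_atTop 0] with t ht using key ht (h₂ t ht)
  · refine Asymptotics.IsBigO.of_bound C₁ ?_
    filter_upwards [self_mem_nhdsWithin] with t ht using key ht (h₁ t ht)

open MeasureTheory in
theorem hasMellin_sum {ι : Type*} {S : Finset ι} {f : ι → ℝ → ℂ} {m : ι → ℂ} {s : ℂ}
    (h : ∀ i ∈ S, HasMellin (f i) s (m i)) :
    HasMellin (fun t => ∑ i ∈ S, f i t) s (∑ i ∈ S, m i) := by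
  constructor
  · simp only [MellinConvergent, Finset.smul_sum]
    exact integrable_finsetSum _ fun i hi => (h i hi).1
  · simp only [mellin, Finset.smul_sum]
    rw [integral_finsetSum _ fun i hi => (h i hi).1]
    exact Finset.sum_congr rfl fun i hi => (h i hi).2

theorem mellin_congr_Ioi {f g : ℝ → ℂ} (h : ∀ x, 0 < x → f x = g x) (s : ℂ) :
    mellin f s = mellin g s :=
  MeasureTheory.setIntegral_congr_fun measurableSet_Ioi fun x hx => by simp only [h x hx]

section dualMellin

open Complex

variable {q : ℕ} {χ : DirichletCharacter ℂ q} {N : ℕ} {h : ℤ}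

/-- The series `G_j` of the conjugate character as a function of `x ^ (-1 / N)`. -/
noncomputable def dualSeries (χ : DirichletCharacter ℂ q) (N : ℕ) (h j : ℤ) : ℝ → ℂ :=
  expSeries (doubleCoeff (star χ) (-((2 * (h : ℝ) - 1) / N)) 0)
    (doubleRate (dualConst N) (1 / N) 1) (dualDir N j)

/-- The exponent `(N - 2h + 1) / N`. -/
noncomputable def dualExponent (N : ℕ) (h : ℤ) : ℝ := ((N : ℝ) - 2 * h + 1) / N

/-- The coefficient of `G_j` in `𝓙_χ`, up to the power of `x`. -/
noncomputable def dualWeight [NeZero q] (χ : DirichletCharacter ℂ q) (N : ℕ) (h j : ℤ) : ℂ :=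
  (-1) ^ (h + 1) * (gaussSum χ ZMod.stdAddChar / N) * (2 * Real.pi) ^ (dualExponent N h : ℂ) *
    (vCoeff N χ j * cexp (I * Real.pi * (j : ℂ) * (2 * h - 1) / (2 * N)))

theorem abs_dualIndex_lt {k : ℕ} (hk : k ∈ Finset.range N) :
    |2 * (k : ℤ) - ((N : ℤ) - 1)| < N := by
  rw [Finset.mem_range] at hk
  rw [abs_lt]
  omega

theorem dualJ_eq_sum [NeZero q] (χ : DirichletCharacter ℂ q) (hN : 1 ≤ N) (h : ℤ) {x : ℝ} (hx : 0 < x) :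
    dualJ N h x χ = ∑ k ∈ Finset.range N, dualWeight χ N h (2 * (k : ℤ) - ((N : ℤ) - 1)) •
      ((x : ℂ) ^ (-(dualExponent N h : ℂ)) •
        dualSeries χ N h (2 * (k : ℤ) - ((N : ℤ) - 1)) (x ^ (-(1 / N : ℝ)))) := by
  rw [dualJ, Finset.mul_sum]
  refine Finset.sum_congr rfl fun k hk => ?_
  rw [(dual_eq (star χ) hN hx (abs_dualIndex_lt hk) _).2, Real.div_rpow (by positivity) hx.le,
    ofReal_div, ofReal_cpow (by positivity), ofReal_cpow hx.le, div_eq_mul_inv _ ((x : ℂ) ^ _),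
    ← cpow_neg, dualWeight, dualSeries, dualExponent, smul_eq_mul, smul_eq_mul]
  push_cast
  ring

theorem exists_norm_dualSeries_le (χ : DirichletCharacter ℂ q) (hN : 1 ≤ N) (h : ℤ) {j : ℤ}
    (hj : |j| < N) {σ : ℝ} (hσ : N * (2 + |(2 * (h : ℝ) - 1) / N|) ≤ σ) :
    ∃ C, ∀ t, 0 < t → ‖dualSeries χ N h j t‖ ≤ C * t ^ (-σ) :=
  have hc := dual_spec hN hσ
  exists_norm_expSeries_le (doubleRate_pos _ _ (dualConst_pos N)) (dualDir_re_pos hN hj) hc.1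
    (summable_doubleCoeff _ (dualConst_pos N) hc.2.1 hc.2.2)

theorem continuousOn_dualSeries (χ : DirichletCharacter ℂ q) (hN : 1 ≤ N) (h : ℤ) {j : ℤ}
    (hj : |j| < N) : ContinuousOn (dualSeries χ N h j) (Set.Ioi 0) :=
  have hc := dual_spec hN le_rfl
  continuousOn_expSeries (doubleRate_pos _ _ (dualConst_pos N)) (dualDir_re_pos hN hj) hc.1
    (summable_doubleCoeff _ (dualConst_pos N) hc.2.1 hc.2.2)

theorem dualDir_cpow_neg (hN : 1 ≤ N) {j : ℤ} (hj : |j| < N) (w : ℂ) :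
    dualDir N j ^ (-w) = cexp (I * Real.pi * j * w / (2 * N)) := by
  have hN' : (0 : ℝ) < N := by exact_mod_cast hN
  have hre := dualDir_re_pos hN hj
  have h2 : |(j : ℝ)| < N := by exact_mod_cast hj
  have him : (-(I * (Real.pi : ℂ) * j / (2 * N))).im = -(Real.pi * j / (2 * N)) := by
    rw [show (-(I * (Real.pi : ℂ) * j / (2 * N))) = ((-(Real.pi * j / (2 * N)) : ℝ) : ℂ) * I by
      push_cast; ring, im_ofReal_mul, I_im, mul_one]
  have h3 : |-(Real.pi * j / (2 * N))| < Real.pi := by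
    rw [abs_neg, abs_div, abs_mul, abs_of_pos Real.pi_pos, abs_of_pos (by positivity : (0 : ℝ) < 2 * N),
      div_lt_iff₀ (by positivity)]
    nlinarith [Real.pi_pos]
  rw [cpow_def_of_ne_zero (by simp [dualDir]), dualDir, log_exp (by rw [him]; exact (abs_lt.1 h3).1)
    (by rw [him]; exact (abs_lt.1 h3).2.le)]
  congr 1
  ring

theorem hasMellin_dualSummand [NeZero q] (hN : 1 ≤ N) {j : ℤ} (hj : |j| < N) {s w : ℂ}
    (hw : w = N - 2 * h + 1 - N * s) (hre : N * (2 + |(2 * (h : ℝ) - 1) / N|) < w.re) :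
    HasMellin (fun x : ℝ => (x : ℂ) ^ (-(dualExponent N h : ℂ)) •
      dualSeries χ N h j (x ^ (-(1 / N : ℝ)))) s
      (N * (Gamma w * cexp (I * Real.pi * j * w / (2 * N)) * ((dualConst N : ℂ) ^ (-w) *
        (DirichletCharacter.LFunction (star χ) (1 - s) * riemannZeta w)))) := by
  have hN' : (0 : ℝ) < N := by exact_mod_cast hN
  have hNC : (N : ℂ) ≠ 0 := by exact_mod_cast hN'.ne'
  have hneg : (-(1 / N : ℝ)) ≠ 0 := by simp [hN'.ne']
  -- The substitution `t = x ^ (-1/N)`, after the power prefactor, carries the Mellin variable `s`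
  -- to `w` and contributes the factor `N`.
  have hsw : (s + -(dualExponent N h : ℂ)) / ((-(1 / N : ℝ) : ℝ) : ℂ) = w := by
    rw [hw, dualExponent]
    push_cast
    field_simp
    ring
  constructor
  · rw [MellinConvergent.cpow_smul, MellinConvergent.comp_rpow hneg, hsw]
    exact mellinConvergent_of_rpow_bounds (continuousOn_dualSeries χ hN h hj)
      (fun σ hσ => exists_norm_dualSeries_le χ hN h hj hσ) hre
  · have hc := dual_spec hN hre.le
    rw [mellin_cpow_smul, mellin_comp_rpow, hsw, dualSeries,
      mellin_doubleSeries _ (dualConst_pos N) (dualDir_re_pos hN hj) hc.1 hc.2.1 hc.2.2,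
      dualDir_cpow_neg hN hj, abs_neg, abs_of_pos (by positivity),
      show (((1 / N : ℝ) : ℂ) * w - ((-((2 * (h : ℝ) - 1) / N) : ℝ) : ℂ)) = 1 - s by
        rw [hw]; push_cast; field_simp; ring]
    simp

/-- The Mellin transform of `x ↦ 𝓙_χ(x)`. -/
theorem mellin_dualJ [NeZero q] (hχ : χ.IsPrimitive) (hN : 1 ≤ N) (hparity : χ.Even ∨ (χ.Odd ∧ Even N))
    {s : ℂ} (hs : s.im ≠ 0)
    (hre : N * (2 + |(2 * (h : ℝ) - 1) / N|) < (N : ℝ) - 2 * h + 1 - N * s.re) :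
    mellin (fun y => dualJ N h (q * y) χ) s =
      Gamma s * DirichletCharacter.LFunction χ s * riemannZeta (N * s - N + 2 * h) := by
  have hN' : (0 : ℝ) < N := by exact_mod_cast hN
  have hNC : (N : ℂ) ≠ 0 := by exact_mod_cast hN'.ne'
  have hq : (0 : ℝ) < q := Nat.cast_pos.2 (NeZero.pos q)
  set w : ℂ := N - 2 * h + 1 - N * s with hw
  have hwre : w.re = (N : ℝ) - 2 * h + 1 - N * s.re := by
    simp [hw]
  have hpi : (2 * Real.pi : ℂ) ≠ 0 := by simp [Real.pi_ne_zero]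
  -- Dilating the variable by `q` produces the factor `q ^ (-s)` of the functional equation.
  rw [completed_functional_equation hχ hN h hparity hs hw,
    mellin_comp_mul_left (fun y => dualJ N h y χ) s hq,
    mellin_congr_Ioi (fun x hx => dualJ_eq_sum χ hN h hx)]
  have hsum := hasMellin_sum (S := Finset.range N) fun k hk => hasMellin_const_smul
    (hasMellin_dualSummand (χ := χ) (h := h) hN (abs_dualIndex_lt hk) hw (hwre ▸ hre)).1
    (dualWeight χ N h (2 * (k : ℤ) - ((N : ℤ) - 1)))
  rw [hsum.2, smul_eq_mul, Finset.mul_sum, Finset.mul_sum]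
  refine Finset.sum_congr rfl fun k hk => ?_
  rw [(hasMellin_dualSummand (χ := χ) (h := h) hN (abs_dualIndex_lt hk) hw (hwre ▸ hre)).2,
    dualWeight]
  set j : ℤ := 2 * (k : ℤ) - ((N : ℤ) - 1)
  have hC : (dualConst N : ℂ) ^ (-w) = (2 * Real.pi) ^ (-w) * (2 * Real.pi) ^ (-w / N) := by
    rw [dualConst, ofReal_mul, mul_cpow_ofReal_nonneg (by positivity) (by positivity),
      ← cpow_mul_ofReal_nonneg (by positivity)]
    push_cast
    congr 2
    ring
  have hpow : (2 * Real.pi : ℂ) ^ (s - w) =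
      (2 * Real.pi) ^ (dualExponent N h : ℂ) * ((2 * Real.pi) ^ (-w) * (2 * Real.pi) ^ (-w / N)) := by
    rw [← cpow_add _ _ hpi, ← cpow_add _ _ hpi]
    congr 1
    rw [hw, dualExponent]
    push_cast
    field_simp
    ring
  have hexp : cexp (I * Real.pi * (j : ℂ) * ((1 - s) / 2)) =
      cexp (I * Real.pi * (j : ℂ) * (2 * h - 1) / (2 * N)) *
        cexp (I * Real.pi * j * w / (2 * N)) := by
    rw [← exp_add]
    congr 1
    rw [hw]
    field_simp
    ring
  rw [hC, hpow, hexp, smul_eq_mul, ofReal_natCast]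
  field_simp

end dualMellin

section dualBounds

open Complex

variable {q : ℕ} [NeZero q] {N : ℕ}

theorem exists_norm_dualJ_le (χ : DirichletCharacter ℂ q) (hN : 1 ≤ N) (h : ℤ) {σ : ℝ}
    (hσ : N * (2 + |(2 * (h : ℝ) - 1) / N|) ≤ (N : ℝ) - 2 * h + 1 - N * σ) :
    ∃ C, ∀ x, 0 < x → ‖dualJ N h x χ‖ ≤ C * x ^ (-σ) := by
  have hN' : (0 : ℝ) < N := by exact_mod_cast hN
  have hb : ∀ k : ℕ, ∃ C, k ∈ Finset.range N → ∀ t, 0 < t →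
      ‖dualSeries χ N h (2 * (k : ℤ) - ((N : ℤ) - 1)) t‖ ≤
        C * t ^ (-((N : ℝ) - 2 * h + 1 - N * σ)) := fun k => by
    by_cases hk : k ∈ Finset.range N
    · exact (exists_norm_dualSeries_le χ hN h (abs_dualIndex_lt hk) hσ).imp fun _ hC _ => hC
    · exact ⟨0, fun hk' => absurd hk' hk⟩
  choose C hC using hb
  refine ⟨∑ k ∈ Finset.range N, ‖dualWeight χ N h (2 * (k : ℤ) - ((N : ℤ) - 1))‖ * C k,
    fun x hx => ?_⟩
  rw [dualJ_eq_sum χ hN h hx, Finset.sum_mul]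
  refine norm_sum_le_of_le _ fun k hk => ?_
  have h1 := hC k hk (x ^ (-(1 / N : ℝ))) (Real.rpow_pos_of_pos hx _)
  -- The exponent for the series in `x ^ (-1/N)` is chosen so that the power prefactor of `𝓙_χ`
  -- cancels and exactly `x ^ (-σ)` is left.
  have h2 : (x ^ (-(1 / N : ℝ))) ^ (-((N : ℝ) - 2 * h + 1 - N * σ)) =
      x ^ dualExponent N h * x ^ (-σ) := by
    rw [← Real.rpow_mul hx.le, ← Real.rpow_add hx, dualExponent]
    congr 1
    field_simp
    ring
  have h3 : ‖(x : ℂ) ^ (-(dualExponent N h : ℂ))‖ = x ^ (-dualExponent N h) := by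
    rw [norm_cpow_eq_rpow_re_of_pos hx, neg_re, ofReal_re]
  have h4 : x ^ (-dualExponent N h) * x ^ dualExponent N h = 1 := by
    rw [← Real.rpow_add hx, neg_add_cancel, Real.rpow_zero]
  rw [norm_smul, norm_smul, h3, mul_assoc]
  refine mul_le_mul_of_nonneg_left ?_ (norm_nonneg _)
  calc _ ≤ x ^ (-dualExponent N h) * (C k * (x ^ dualExponent N h * x ^ (-σ))) := by
        rw [← h2]
        exact mul_le_mul_of_nonneg_left h1 (Real.rpow_nonneg hx.le _)
    _ = C k * x ^ (-σ) := by linear_combination (C k * x ^ (-σ)) * h4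

theorem continuousOn_dualJ (χ : DirichletCharacter ℂ q) (hN : 1 ≤ N) (h : ℤ) :
    ContinuousOn (fun x => dualJ N h x χ) (Set.Ioi 0) := by
  refine ContinuousOn.congr (continuousOn_finsetSum _ fun k hk => ?_)
    fun x hx => dualJ_eq_sum χ hN h hx
  simp only [smul_eq_mul]
  refine continuousOn_const.mul (ContinuousOn.mul ?_ ?_)
  · exact fun x hx => (continuousAt_ofReal_cpow_const x _ (Or.inr (ne_of_gt hx))).continuousWithinAt
  · refine (continuousOn_dualSeries χ hN h (abs_dualIndex_lt hk)).comp
      (fun x hx => (Real.continuousAt_rpow_const x _ (Or.inl (ne_of_gt hx))).continuousWithinAt)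
      fun x hx => Real.rpow_pos_of_pos hx _

end dualBounds

/-! ### Assembling the expansion -/

section expansion

open Complex

variable {q : ℕ} [NeZero q] {χ : DirichletCharacter ℂ q} {N : ℕ} {h : ℤ}

/-- The Lambert series minus its dual is the sum over the poles of the completed function. -/
theorem lambertF_eq_add_sum_residues (hχ : χ.IsPrimitive) (hN : 1 ≤ N)
    (hNh : (N : ℤ) - 2 * h ≠ -1) (hparity : χ.Even ∨ (χ.Odd ∧ Even N)) {ℓ : ℂ}
    (hℓ : Filter.Tendsto (fun s => Complex.Gamma s * DirichletCharacter.LFunction χ s)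
      (𝓝[≠] (((N : ℂ) - 2 * h + 1) / N)) (𝓝 ℓ)) {x : ℝ} (hx : 0 < x) :
    lambertF N h x χ = dualJ N h x χ +
      ∑ i ∈ Finset.range ((2 * ⌊(h : ℝ) / (N : ℝ)⌋ + 1).toNat + 3),
        poleRes χ N h ℓ i * ((x / q : ℝ) : ℂ) ^ (-poleLoc N h i : ℂ) := by
  have hN1 : (1 : ℝ) ≤ N := by exact_mod_cast hN
  have hN0 : (N : ℝ) ≠ 0 := by positivity
  have hq : (0 : ℝ) < q := Nat.cast_pos.2 (NeZero.pos q)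
  obtain ⟨E, hE, hEM⟩ := exists_entire_completed hχ hN hNh hparity hℓ
  set S := Finset.range ((2 * ⌊(h : ℝ) / (N : ℝ)⌋ + 1).toNat + 3)
  set a : ℝ := (2 * (h : ℝ) - 1) / N with ha
  set P : ℝ := ∑ i ∈ S, |poleLoc N h i| with hP
  have hP0 : 0 ≤ P := Finset.sum_nonneg fun i _ => abs_nonneg _
  have ha0 : 0 ≤ |a| := abs_nonneg a
  have hh0 : 0 ≤ |2 * (h : ℝ)| := abs_nonneg _
  -- The three summands put the Lambert side to the right of `c`, the dual side to the left of `-c`,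
  -- and all listed poles between them.
  set c : ℝ := convBound h + |a| + P with hc
  have hcB : convBound h ≤ c := by linarith
  have hc0 : 0 < c := (convBound_spec hN h hcB).1
  have hdual : ∀ σ : ℝ, σ ≤ -c → N * (2 + |a|) < (N : ℝ) - 2 * h + 1 - N * σ := fun σ hσ => by
    have h1 : (N : ℝ) * (3 + |2 * (h : ℝ)| + |a|) ≤ N * (-σ) := by
      refine mul_le_mul_of_nonneg_left ?_ (by linarith)
      have : c = 3 + |2 * (h : ℝ)| + |a| + P := rfl
      linarith
    have h2 := le_abs_self (2 * (h : ℝ))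
    have h3 : |2 * (h : ℝ)| ≤ N * |2 * (h : ℝ)| := le_mul_of_one_le_left hh0 hN1
    linarith
  have hgrow : ExpTypeOnStrips fun s => Complex.Gamma s * DirichletCharacter.LFunction χ s *
      riemannZeta (N * s - N + 2 * h) := by
    refine ((ExpTypeOnStrips.Gamma.mul (ExpTypeOnStrips.LFunction χ)).mul
      (ExpTypeOnStrips.riemannZeta.comp_affine hN0 (2 * h - N))).congr fun s _ => ?_
    rw [DirichletCharacter.LFunction]
    push_cast
    ring_nf
  obtain ⟨A, B, hAB⟩ := hgrow (c + 1) 1 one_pos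
  have hgc : ContinuousOn (fun y : ℝ => dualJ N h (q * y) χ) (Set.Ioi 0) :=
    (continuousOn_dualJ χ hN h).comp (by fun_prop) fun y hy => mul_pos hq hy
  have hgb : ∀ σ, σ ≤ -c → ∃ C, ∀ y : ℝ, 0 < y → ‖dualJ N h (q * y) χ‖ ≤ C * y ^ (-σ) :=
    fun σ hσ => by
      obtain ⟨C, hC⟩ := exists_norm_dualJ_le χ hN h (hdual σ hσ).le
      refine ⟨C * (q : ℝ) ^ (-σ), fun y hy => (hC _ (mul_pos hq hy)).trans (le_of_eq ?_)⟩
      rw [Real.mul_rpow hq.le hy.le]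
      ring
  have hf : ∀ σ, c ≤ σ → 0 < σ ∧ Summable fun i =>
      ‖doubleCoeff χ 0 ((N : ℝ) - 2 * h) i‖ * doubleRate 1 1 N i ^ (-σ) := fun σ hσ => by
    have := convBound_spec hN h (hcB.trans hσ)
    exact ⟨this.1, summable_doubleCoeff χ one_pos this.2.1 this.2.2⟩
  have key := eq_add_sum_residues (x := x / q) (c := c) (S := S) (p := poleLoc N h)
    (r := poleRes χ N h ℓ) hc0
    (fun i hi => by
      have := Finset.single_le_sum (f := fun i => |poleLoc N h i|) (fun i _ => abs_nonneg _) hi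
      have h3 : c = 3 + |2 * (h : ℝ)| + |a| + P := rfl
      linarith)
    (continuousOn_expSeries (ω := 1) (doubleRate_pos 1 N one_pos) (by simp) (hf c le_rfl).1
      (hf c le_rfl).2) hgc
    (fun σ hσ => exists_norm_expSeries_le (doubleRate_pos 1 N one_pos) (by simp) (hf σ hσ).1
      (hf σ hσ).2)
    hgb
    (fun s hs _ => by
      have := convBound_spec hN h (hcB.trans hs.le)
      rw [mellin_doubleSeries χ one_pos (by simp) this.1 this.2.1 this.2.2, one_cpow, ofReal_one,
        one_cpow, mul_one, one_mul, mul_assoc]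
      push_cast
      ring_nf)
    (fun s hs him => mellin_dualJ hχ hN hparity him (hdual _ hs.le))
    hE hEM hAB (div_pos hx hq)
  rw [(lambert_eq χ hN h hx).2, key, mul_div_cancel₀ _ hq.ne']

theorem sum_poleRes_mul_cpow (χ : DirichletCharacter ℂ q) (N : ℕ) (h : ℤ) (ℓ : ℂ) (J : ℕ) {x : ℝ}
    (hx : 0 < x) :
    ∑ i ∈ Finset.range (J + 3), poleRes χ N h ℓ i * ((x / q : ℝ) : ℂ) ^ (-poleLoc N h i : ℂ) =
      riemannZeta (-(N : ℂ) + 2 * (h : ℂ)) * DirichletCharacter.LFunction χ 0 +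
        residueOne q h x +
        1 / (N : ℂ) * ℓ *
          (((x / (q : ℝ)) ^ ((2 * (h : ℝ) - (N : ℝ) - 1) / (N : ℝ)) : ℝ) : ℂ) +
        ∑ j ∈ Finset.Icc 1 J,
          (-1) ^ (j + 1) / ((j + 1).factorial : ℂ) * bernoulliChar (j + 1) χ *
            riemannZeta (-(N : ℂ) * (j : ℂ) - (N : ℂ) + 2 * (h : ℂ)) *
              ((x : ℂ) / (q : ℂ)) ^ j := by
  have hq : (0 : ℝ) < q := Nat.cast_pos.2 (NeZero.pos q)
  have h1 : poleRes χ N h ℓ 0 * ((x / q : ℝ) : ℂ) ^ (-poleLoc N h 0 : ℂ) = residueOne q h x := by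
    rw [poleRes, poleLoc, residueOne]
    split_ifs with h
    · subst h
      simp [cpow_neg, div_eq_mul_inv]
    · rw [zero_mul]
  have h2 : poleRes χ N h ℓ 1 * ((x / q : ℝ) : ℂ) ^ (-poleLoc N h 1 : ℂ) = 1 / (N : ℂ) * ℓ *
      (((x / (q : ℝ)) ^ ((2 * (h : ℝ) - (N : ℝ) - 1) / (N : ℝ)) : ℝ) : ℂ) := by
    rw [poleRes, poleLoc, ofReal_cpow (by positivity)]
    push_cast
    ring_nf
  have h3 : ∀ j : ℕ, poleRes χ N h ℓ (j + 2) * ((x / q : ℝ) : ℂ) ^ (-poleLoc N h (j + 2) : ℂ) =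
      (-1) ^ j / j.factorial * DirichletCharacter.LFunction χ (-j) *
        riemannZeta (-(N : ℂ) * j - N + 2 * h) * ((x : ℂ) / q) ^ j := fun j => by
    rw [poleRes, poleLoc]
    push_cast
    rw [neg_neg, cpow_natCast]
  have h4 : ∀ j ∈ Finset.Icc 1 J, (-1) ^ j / j.factorial * DirichletCharacter.LFunction χ (-j) *
      riemannZeta (-(N : ℂ) * j - N + 2 * h) * ((x : ℂ) / q) ^ j =
      (-1) ^ (j + 1) / ((j + 1).factorial : ℂ) * bernoulliChar (j + 1) χ *
        riemannZeta (-(N : ℂ) * (j : ℂ) - (N : ℂ) + 2 * (h : ℂ)) * ((x : ℂ) / (q : ℂ)) ^ j :=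
    -- The residue of `Γ` at `-j` times `L(-j, χ) = -B_{j+1,χ} / (j + 1)` gives the coefficient
    -- `(-1)^(j+1) / (j+1)!`.
    fun j hj => by
      have hj0 : j ≠ 0 := by have := (Finset.mem_Icc.1 hj).1; omega
      have hj1 : (j : ℂ) + 1 ≠ 0 := by exact_mod_cast j.succ_ne_zero
      have hjf : (j.factorial : ℂ) ≠ 0 := by exact_mod_cast j.factorial_ne_zero
      rw [LFunction_neg_nat χ hj0, Nat.factorial_succ]
      push_cast
      field_simp
      ring
  -- Removing the entries `0` and `1` leaves `j = 0, …, J`; the term `j = 0` is `ζ(2h - N) L(0, χ)`,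
  -- kept apart from the Bernoulli sum.
  rw [Finset.sum_range_succ', Finset.sum_range_succ', h1, h2, Finset.sum_congr rfl fun j _ => h3 j,
    ← Finset.sum_congr rfl h4, Finset.range_eq_Ico, Finset.sum_eq_sum_Ico_succ_bot J.succ_pos,
    ← Finset.Ico_succ_right_eq_Icc]
  simp
  ring

end expansion

theorem theorem2p1 {q : ℕ} [NeZero q] (χ : DirichletCharacter ℂ q) (hχ : χ.IsPrimitive)
    (N : ℕ) (hN : 1 ≤ N) (h : ℤ) (hNh : (N : ℤ) - 2 * h ≠ -1) (x : ℝ) (hx : 0 < x)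
    (hparity : χ.Even ∨ (χ.Odd ∧ Even N)) :
    (∀ r ∈ Finset.Icc 1 q, Summable fun n : ℕ => lambertTerm N h x χ r (n + 1)) ∧
    (∀ k ∈ Finset.range N, Summable fun n : ℕ =>
      dualTerm N (2 * (k : ℤ) - ((N : ℤ) - 1)) ((2 * (h : ℝ) - 1) / (N : ℝ)) (2 * Real.pi / x)
        (star χ) (n + 1)) ∧
    ∃ ℓ : ℂ,
      Filter.Tendsto (fun s : ℂ => Complex.Gamma s * DirichletCharacter.LFunction χ s)
        (𝓝[≠] (((N : ℂ) - 2 * (h : ℂ) + 1) / (N : ℂ))) (𝓝 ℓ) ∧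
      lambertF N h x χ =
        riemannZeta (-(N : ℂ) + 2 * (h : ℂ)) * DirichletCharacter.LFunction χ 0 +
        residueOne q h x +
        1 / (N : ℂ) * ℓ *
          (((x / (q : ℝ)) ^ ((2 * (h : ℝ) - (N : ℝ) - 1) / (N : ℝ)) : ℝ) : ℂ) +
        ∑ j ∈ Finset.Icc 1 (2 * ⌊(h : ℝ) / (N : ℝ)⌋ + 1).toNat,
          (-1) ^ (j + 1) / ((j + 1).factorial : ℂ) * bernoulliChar (j + 1) χ *
            riemannZeta (-(N : ℂ) * (j : ℂ) - (N : ℂ) + 2 * (h : ℂ)) *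
              ((x : ℂ) / (q : ℂ)) ^ j +
        dualJ N h x χ := by
  obtain ⟨ℓ, hℓ⟩ := exists_tendsto_Gamma_mul_LFunction hN hNh hparity
  refine ⟨(lambert_eq χ hN h hx).1, fun k hk => (dual_eq (star χ) hN hx (abs_dualIndex_lt hk) _).1,
    ℓ, hℓ, ?_⟩
  rw [lambertF_eq_add_sum_residues hχ hN hNh hparity hℓ hx, sum_poleRes_mul_cpow χ N h ℓ _ hx,
    add_comm]
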